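/- Let $d\ge 1$, $s,J\in\mathbb N$ with $J<s-d/2$, and let $\delta\in(0,1)$. Let $\Omega\subset\mathbb R^d$ be a bounded domain with Lipschitz boundary and $\mathrm{diam}(\Omega)\le 1$. Let $H_0^s(\Omega)$ be the closure of $C_0^\infty(\Omega)$ in the norm $\|u\|^2=\sum_{|\gamma|\le s}\|D^\gamma u\|_{L^2}^2$, let $H^{-s}(\Omega)$ be its dual with the dual norm, and let $[\cdot,\cdot]$ be the duality pairing. Let $\mathcal L:H_0^s(\Omega)\to H^{-s}(\Omega)$ be a linear bijection that is bounded with bounded inverse, symmetric ($[u,\mathcal Lv]=[v,\mathcal Lu]$), positive definite ($[u,\mathcal Lu]>0$ for $u\neq0$) and local ($[u,\mathcal Lv]=0$ if $u$ and $v$ have disjoint supports). Let $K(\mathbf x,\mathbf y)=[\delta_{\mathbf x},\mathcal L^{-1}\delta_{\mathbf y}]$ be its Green function, where $\delta_{\mathbf x}$ is the Dirac functional at $\mathbf x$. Let $h>0$ and let $\tau_1,\dots,\tau_Q$ be a partition of $\Omega$ such that the closure of each $\tau_i$ is convex, contains the ball of center $\mathbf x_i$ and radius $\delta h$, and is contained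 in the ball of center $\mathbf x_i$ and radius $h/\delta$. For each $1\le i\le Q$ let $\phi_{i,\alpha}\in H^{-s}(\Omega)$, $\alpha\in\mathsf T_i$ ($\mathsf T_i$ finite), be such that $$\{\delta_{\mathbf x_i}\}\subset\{\phi_{i,\alpha}:\alpha\in\mathsf T_i\}\subset\{\delta_{\mathbf x_i}\circ D^\gamma:0\le|\gamma|\le J\},$$ the $\phi_{i,\alpha}$, $\alpha\in\mathsf T_i$, are linearly independent as functionals on $H_0^s(\tau_i)\subset H_0^s(\Omega)$, and $[\phi_{i,\alpha},\psi]=0$ for every $\psi\in C_0^\infty(\Omega\setminus\tau_i)$. Let $\boldsymbol\phi$ be the collection of all $\phi_{i,\alpha}$, and let $K(\boldsymbol\phi,\boldsymbol\phi)$ be the matrix with entries $\iint K(\mathbf x,\mathbf y)\phi_{i,\alpha}(\mathbf x)\phi_{k,\beta}(\mathbf y)\,\mathrm d\mathbf x\,\mathrm d\mathbf y$, where the integrals stand for duality pairings. Then $$C_{\max}\,h^{-d}\,\mathrm I\succeq K(\boldsymbol\phi,\boldsymbol\phi)\succeq C_{\min}\,h^{2s-d}\,\mathrm I,$$ where $C_{\min}>0$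 depends only on $\delta,d,s,J,\|\mathcal L\|,\|\mathcal L^{-1}\|$, the constant $C_{\max}>0$ depends in addition only on $\Omega$, and $\mathrm I$ is the identity matrix. -/

import Mathlib

open MeasureTheory Set
open scoped ContDiff Topology

noncomputable section

namespace KernelBounds

/-- Euclidean space `ℝ^d`. -/
abbrev E (d : ℕ) : Type := EuclideanSpace ℝ (Fin d)

/-! ### Classical derivatives and test functions -/

/-- The partial derivative of `f` in the `j`-th coordinate. -/
def pderiv {d : ℕ} (j : Fin d) (f : E d → ℝ) : E d → ℝ :=
  fun x => fderiv ℝ f x (EuclideanSpace.single j 1)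

/-- `D^γ f = D_1^{γ_1} ⋯ D_d^{γ_d} f` for a multi-index `γ`. -/
def mderiv {d : ℕ} (γ : Fin d → ℕ) (f : E d → ℝ) : E d → ℝ :=
  (List.finRange d).foldr (fun j g => (pderiv j)^[γ j] g) f

/-- `f ∈ C_0^∞(S)`: smooth on `ℝ^d`, with compact support contained in `S`. -/
structure IsTest {d : ℕ} (S : Set (E d)) (f : E d → ℝ) : Prop where
  smooth : ContDiff ℝ ∞ f
  compact : HasCompactSupport f
  subset : tsupport f ⊆ S

theorem IsTest.pderiv {d : ℕ} {S : Set (E d)} {f : E d → ℝ} (hf : IsTest S f) (j : Fin d) :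
    IsTest S (pderiv j f) where
  smooth := (hf.smooth.fderiv_right (m := ∞) (by simp)).clm_apply contDiff_const
  compact := hf.compact.fderiv_apply (𝕜 := ℝ) _
  subset := (tsupport_fderiv_apply_subset ℝ _).trans hf.subset

theorem IsTest.mderiv {d : ℕ} {S : Set (E d)} {f : E d → ℝ} (hf : IsTest S f)
    (γ : Fin d → ℕ) : IsTest S (mderiv γ f) := by
  unfold KernelBounds.mderiv
  induction List.finRange d with
  | nil => exact hf
  | cons j l ih =>
    simp only [List.foldr_cons]
    induction γ j with
    | zero => exact ih
    | succ n ihn =>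
      rw [Function.iterate_succ_apply']
      exact ihn.pderiv j

theorem IsTest.memLp {d : ℕ} {S : Set (E d)} {f : E d → ℝ} (hf : IsTest S f) :
    MemLp f 2 (volume : Measure (E d)) :=
  hf.smooth.continuous.memLp_of_hasCompactSupport hf.compact

/-! ### The Sobolev space `H_0^s` and its dual -/

/-- Multi-indices `γ ∈ ℕ^d` with `|γ| ≤ s`. -/
def MultiIndex (d s : ℕ) : Type := {γ : Fin d → ℕ // ∑ j, γ j ≤ s}

instance (d s : ℕ) : Finite (MultiIndex d s) :=
  Finite.of_injective
    (fun (γ : MultiIndex d s) (j : Fin d) => (⟨γ.1 j, Nat.lt_succ_of_le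
      ((Finset.single_le_sum (fun _ _ => Nat.zero_le _) (Finset.mem_univ j)).trans γ.2)⟩ :
        Fin (s + 1)))
    (fun _ _ h => Subtype.ext (funext fun j => congrArg Fin.val (congrFun h j)))

instance (d s : ℕ) : Fintype (MultiIndex d s) := Fintype.ofFinite _

/-- Families `(u_γ)_{|γ| ≤ s}` of elements of `L²(ℝ^d)`, with the Hilbert norm
`(∑_γ ‖u_γ‖²)^{1/2}`. A function of class `H^s` is represented by the family of its weak
derivatives, and then this norm is its `H^s` norm. -/
abbrev Jet (d s : ℕ) : Type :=
  PiLp 2 (fun _ : MultiIndex d s => Lp ℝ 2 (volume : Measure (E d)))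

/-- A test function as an element of `H^s`: the family of its derivatives. -/
def IsTest.toJet {d : ℕ} {S : Set (E d)} {f : E d → ℝ} (s : ℕ) (hf : IsTest S f) : Jet d s :=
  WithLp.toLp 2 (fun γ => ((hf.mderiv γ.1).memLp).toLp (KernelBounds.mderiv γ.1 f))

/-- `H_0^s(S)` as a subspace of the space of jets: the closure of `C_0^∞(S)` in the `H^s` norm
`‖u‖² = ∑_{|γ| ≤ s} ‖D^γ u‖²_{L²}`. Its elements are extended by zero outside `S`, so that
`H_0^s(S) ⊆ H_0^s(Ω)` for `S ⊆ Ω`. -/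
def H0Sub {d : ℕ} (s : ℕ) (S : Set (E d)) : Submodule ℝ (Jet d s) :=
  (Submodule.span ℝ {u | ∃ (f : E d → ℝ) (hf : IsTest S f), u = hf.toJet s}).topologicalClosure

/-- The Hilbert space `H_0^s(S)`, with the norm of `H^s`. -/
def H0 {d : ℕ} (s : ℕ) (S : Set (E d)) : Type := H0Sub s S

instance {d : ℕ} (s : ℕ) (S : Set (E d)) : NormedAddCommGroup (H0 s S) :=
  inferInstanceAs (NormedAddCommGroup (H0Sub s S))

instance {d : ℕ} (s : ℕ) (S : Set (E d)) : InnerProductSpace ℝ (H0 s S) :=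
  inferInstanceAs (InnerProductSpace ℝ (H0Sub s S))

/-- The inclusion of `H_0^s(S)` in the space of jets, `u ↦ (D^γ u)_{|γ| ≤ s}`. -/
def H0.jet {d s : ℕ} {S : Set (E d)} : H0 s S →ₗᵢ[ℝ] Jet d s := (H0Sub s S).subtypeₗᵢ

instance {d : ℕ} (s : ℕ) (S : Set (E d)) : CompleteSpace (H0 s S) :=
  inferInstanceAs (CompleteSpace (Submodule.topologicalClosure _))

/-- A test function as an element of `H_0^s(S)`. -/
def IsTest.toH0 {d : ℕ} {S : Set (E d)} {f : E d → ℝ} (s : ℕ) (hf : IsTest S f) : H0 s S :=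
  (⟨hf.toJet s, Submodule.le_topologicalClosure _ (Submodule.subset_span ⟨f, hf, rfl⟩)⟩ :
    H0Sub s S)

/-- `H^{-s}(Ω)`: the dual of `H_0^s(Ω)`, with the dual norm; the pairing `[u, φ]` is `φ u`. -/
abbrev Hneg {d : ℕ} (s : ℕ) (Ω : Set (E d)) : Type := StrongDual ℝ (H0 s Ω)

/-- The function (an element of `L²(ℝ^d)`, zero outside `Ω`) underlying `u ∈ H_0^s(Ω)`. -/
def H0.toLp {d s : ℕ} {Ω : Set (E d)} (u : H0 s Ω) : Lp ℝ 2 (volume : Measure (E d)) :=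
  H0.jet u (⟨0, by simp⟩ : MultiIndex d s)

/-- The support of `u ∈ H_0^s(Ω)`: the complement of the largest open set on which `u = 0`
almost everywhere. -/
def H0.support {d s : ℕ} {Ω : Set (E d)} (u : H0 s Ω) : Set (E d) :=
  {x | ∀ U ∈ 𝓝 x, ¬ ∀ᵐ y ∂(volume.restrict U), (H0.toLp u : E d → ℝ) y = 0}

open Classical in
/-- The measurement `δ_x ∘ D^γ ∈ H^{-s}(Ω)`: the continuous linear functional on `H_0^s(Ω)` with
`[f, δ_x ∘ D^γ] = D^γ f (x)` for `f ∈ C_0^∞(Ω)`. By density there is at most one; for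
`|γ| < s - d/2` there is one (Sobolev embedding). Otherwise the value `0` is used. -/
def diracDeriv {d : ℕ} (s : ℕ) (Ω : Set (E d)) (x : E d) (γ : Fin d → ℕ) : Hneg s Ω :=
  if h : ∃ φ : Hneg s Ω, ∀ (f : E d → ℝ) (hf : IsTest Ω f), φ (hf.toH0 s) = mderiv γ f x
  then h.choose else 0

/-- The Dirac measurement `δ_x ∈ H^{-s}(Ω)`. -/
def dirac {d : ℕ} (s : ℕ) (Ω : Set (E d)) (x : E d) : Hneg s Ω := diracDeriv s Ω x 0

/-! ### The operator, its Green function and the kernel matrix -/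

/-- Symmetry, positive definiteness and locality of `L : H_0^s(Ω) → H^{-s}(Ω)`. (That `L` is
linear and bounded with bounded inverse is part of its type.) -/
structure IsAdmissible {d s : ℕ} {Ω : Set (E d)} (L : H0 s Ω ≃L[ℝ] Hneg s Ω) : Prop where
  symm : ∀ u v, L v u = L u v
  pos : ∀ u, u ≠ 0 → 0 < L u u
  loc : ∀ u v, Disjoint (H0.support u) (H0.support v) → L v u = 0

/-- The Green function `K(x, y) = [δ_x, L⁻¹ δ_y]`. -/
def green {d s : ℕ} {Ω : Set (E d)} (L : H0 s Ω ≃L[ℝ] Hneg s Ω) (x y : E d) : ℝ :=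
  dirac s Ω x (L.symm (dirac s Ω y))

open Classical in
/-- The primal-dual pairing `[g, φ] = "∫ g(x) φ(x) dx"` of a function `g` on `Ω` with
`φ ∈ H^{-s}(Ω)`: it is `[u, φ]` if `g` is (the continuous representative of) `u ∈ H_0^s(Ω)`,
and `0` if `g` is not in `H_0^s(Ω)`. -/
def pairing {d s : ℕ} {Ω : Set (E d)} (g : E d → ℝ) (φ : Hneg s Ω) : ℝ :=
  if h : ∃ u : H0 s Ω, ∀ x ∈ Ω, dirac s Ω x u = g x then φ h.choose else 0

/-- The kernel matrix `K(φ, φ)` with entries `∫∫ K(x, y) φ_m(x) φ_n(y) dx dy`, the integrals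
being primal-dual pairings. -/
def kernelMatrix {d s : ℕ} {Ω : Set (E d)} {ι : Type} (K : E d → E d → ℝ)
    (φ : ι → Hneg s Ω) : Matrix ι ι ℝ :=
  Matrix.of fun m n => pairing (fun x => pairing (fun y => K x y) (φ n)) (φ m)

/-! ### Domains, partitions and measurements -/

/-- The boundary of the open set `Ω` is Lipschitz: near each boundary point, for some unit vector
`ν`, the set `Ω` is the region below the graph, in direction `ν`, of a Lipschitz function on the
hyperplane orthogonal to `ν`. -/
def HasLipschitzBoundary {d : ℕ} (Ω : Set (E d)) : Prop :=
  ∀ p ∈ frontier Ω, ∃ ν : E d, ‖ν‖ = 1 ∧ ∃ r > 0, ∃ (C : NNReal) (g : (ℝ ∙ ν)ᗮ → ℝ),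
    LipschitzWith C g ∧ ∀ x ∈ Metric.ball p r,
      x ∈ Ω ↔ inner ℝ ν x < g ((ℝ ∙ ν)ᗮ.orthogonalProjectionOnto x)

/-- `Ω` is a bounded domain with Lipschitz boundary, of diameter at most one. -/
structure IsLipschitzDomain {d : ℕ} (Ω : Set (E d)) : Prop where
  isOpen : IsOpen Ω
  connected : IsConnected Ω
  bounded : Bornology.IsBounded Ω
  lipschitz : HasLipschitzBoundary Ω
  diam_le : Metric.diam Ω ≤ 1

/-- `τ_1, …, τ_Q` is a partition of `Ω`, with convex closures of size comparable to `h`. -/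
structure IsPartition {d Q : ℕ} (Ω : Set (E d)) (δ h : ℝ) (τ : Fin Q → Set (E d))
    (x : Fin Q → E d) : Prop where
  disjoint : Pairwise fun i j => Disjoint (τ i) (τ j)
  cover : ⋃ i, τ i = Ω
  convex : ∀ i, Convex ℝ (closure (τ i))
  inner : ∀ i, Metric.ball (x i) (δ * h) ⊆ closure (τ i)
  outer : ∀ i, closure (τ i) ⊆ Metric.closedBall (x i) (h / δ)

/-- Linear independence and locality of the measurements `φ_{i,α}`, `α ∈ T_i`. -/
structure IsMeasurementFamily {d s Q : ℕ} (Ω : Set (E d)) (τ : Fin Q → Set (E d))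
    (T : Fin Q → Type) (φ : ∀ i, T i → Hneg s Ω) : Prop where
  /-- As functions on `H_0^s(τ_i) ⊆ H_0^s(Ω)`, the `φ_{i,α}`, `α ∈ T_i`, are independent. -/
  linearIndependent : ∀ i, LinearIndependent ℝ
    (fun (α : T i) (u : {u : H0 s Ω // H0.jet u ∈ H0Sub s (τ i)}) => φ i α u.1)
  /-- `[φ_{i,α}, ψ] = 0` for `ψ ∈ C_0^∞(Ω \ τ_i)`. -/
  loc : ∀ i (α : T i) (ψ : E d → ℝ) (hψ : IsTest Ω ψ), IsTest (Ω \ τ i) ψ →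
    φ i α (hψ.toH0 s) = 0

end KernelBounds

end

noncomputable section

namespace KernelBounds

/-! ### Calculus of partial derivatives -/

/-! For a coefficient vector `c` put `F = ∑ c_m φ_m`. By symmetry of `L` and uniqueness of the
function behind a pairing, the kernel matrix has entries `φ_m (L⁻¹ φ_n)`, so its quadratic form is
`F (L⁻¹ F)` (`kernelMatrix_green`, `dotProduct_kernelMatrix`). Both bounds reduce to estimates in
`H_0^s` on the balls of radius `r = δ h / 2` about the points `x_i`. These balls are pairwise
disjoint, lie in `Ω`, and satisfy `r ≤ 1`.

Upper bound: `F (L⁻¹ F) ≤ ‖L⁻¹‖ ‖F‖²`. By duality, `‖F‖² ≤ D ∑ c_m²` as soon as `∑ φ_m(u)² ≤ D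
‖u‖²`. The Sobolev inequality on a ball of radius `r ≤ 1` carries the factor `r^{-d}`
(`exists_sobolev_ball`). Summing over disjoint balls gives `D` of order `r^{-d}`, because the number
of measurements at one point is at most the number of multi-indices of order at most `J`.

Lower bound: rescaled bumps `ψ_m` supported in the balls are biorthogonal to the `φ_m`, and `u = ∑
c_m ψ_m` satisfies `‖u‖² ≤ D ∑ c_m²` with `D` of order `r^{d-2s}` (`exists_biorthogonal_family`).
Since `F u = ∑ c_m²`, Cauchy–Schwarz for the energy product of `L` gives `(∑ c_m²)² ≤ F (L⁻¹ F) · L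
u u`, where `L u u ≤ ‖L‖ ‖u‖²`. -/

theorem multiIndex_induction {d : ℕ} {P : (Fin d → ℕ) → Prop} (zero : P 0)
    (step : ∀ γ i, P γ → P (γ + Pi.single i 1)) (γ : Fin d → ℕ) : P γ := by
  induction hn : ∑ j, γ j generalizing γ with
  | zero =>
    have : γ = 0 := by
      ext j
      exact (Finset.sum_eq_zero_iff.1 hn) j (Finset.mem_univ j)
    exact this ▸ zero
  | succ n ih =>
    obtain ⟨i, hi⟩ : ∃ i, γ i ≠ 0 := by
      by_contra! h
      simp [h] at hn
    have hγ : γ = (γ - Pi.single i 1) + Pi.single i 1 := by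
      ext j
      rcases eq_or_ne j i with rfl | hj
      · simp; omega
      · simp [hj]
    rw [hγ]
    refine step _ _ (ih _ ?_)
    rw [hγ] at hn
    simp only [Pi.add_apply, Finset.sum_add_distrib, Finset.sum_pi_single', Finset.mem_univ,
      if_true] at hn
    omega

theorem contDiff_pderiv {d : ℕ} {f : E d → ℝ} (hf : ContDiff ℝ ∞ f) (j : Fin d) :
    ContDiff ℝ ∞ (pderiv j f) :=
  (hf.fderiv_right (m := ∞) (by simp)).clm_apply contDiff_const

theorem differentiable_of_smooth {d : ℕ} {f : E d → ℝ} (hf : ContDiff ℝ ∞ f) :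
    Differentiable ℝ f := hf.differentiable (by simp)

theorem pderiv_add {d : ℕ} {f g : E d → ℝ} (hf : ContDiff ℝ ∞ f) (hg : ContDiff ℝ ∞ g)
    (j : Fin d) : pderiv j (f + g) = pderiv j f + pderiv j g := by
  ext x
  simp [pderiv, fderiv_add (differentiable_of_smooth hf x) (differentiable_of_smooth hg x)]

theorem pderiv_smul {d : ℕ} {f : E d → ℝ} (hf : ContDiff ℝ ∞ f) (c : ℝ) (j : Fin d) :
    pderiv j (c • f) = c • pderiv j f := by
  ext x
  simp [pderiv, fderiv_const_smul (differentiable_of_smooth hf x)]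

theorem pderiv_comm {d : ℕ} {f : E d → ℝ} (hf : ContDiff ℝ ∞ f) (i j : Fin d) :
    pderiv i (pderiv j f) = pderiv j (pderiv i f) := by
  have h2 : Differentiable ℝ (fderiv ℝ f) :=
    (hf.fderiv_right (m := ∞) (by simp)).differentiable (by simp)
  have key : ∀ k l : Fin d, ∀ x, pderiv k (pderiv l f) x =
      fderiv ℝ (fderiv ℝ f) x (EuclideanSpace.single k 1) (EuclideanSpace.single l 1) := by
    intro k l x
    unfold pderiv
    rw [fderiv_clm_apply (h2 x) (differentiableAt_const _)]
    simp
  ext x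
  rw [key, key]
  exact second_derivative_symmetric (fun y => (differentiable_of_smooth hf y).hasFDerivAt)
    (h2 x).hasFDerivAt _ _

theorem contDiff_pderiv_iterate {d : ℕ} {f : E d → ℝ} (hf : ContDiff ℝ ∞ f) (j : Fin d) (n : ℕ) :
    ContDiff ℝ ∞ ((pderiv j)^[n] f) := by
  induction n with
  | zero => exact hf
  | succ n ih => rw [Function.iterate_succ_apply']; exact contDiff_pderiv ih j

theorem pderiv_iterate_comm {d : ℕ} {f : E d → ℝ} (hf : ContDiff ℝ ∞ f) (i j : Fin d) (n : ℕ) :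
    pderiv i ((pderiv j)^[n] f) = (pderiv j)^[n] (pderiv i f) := by
  induction n with
  | zero => rfl
  | succ n ih =>
    rw [Function.iterate_succ_apply', Function.iterate_succ_apply',
      pderiv_comm (contDiff_pderiv_iterate hf j n), ih]

theorem contDiff_foldr_pderiv {d : ℕ} {f : E d → ℝ} (hf : ContDiff ℝ ∞ f) (γ : Fin d → ℕ)
    (l : List (Fin d)) : ContDiff ℝ ∞ (l.foldr (fun j g => (pderiv j)^[γ j] g) f) := by
  induction l with
  | nil => exact hf
  | cons j l ih => exact contDiff_pderiv_iterate ih j _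

theorem contDiff_mderiv {d : ℕ} {f : E d → ℝ} (hf : ContDiff ℝ ∞ f) (γ : Fin d → ℕ) :
    ContDiff ℝ ∞ (mderiv γ f) := contDiff_foldr_pderiv hf γ _

@[simp] theorem mderiv_zero {d : ℕ} (f : E d → ℝ) : mderiv 0 f = f := by
  unfold mderiv
  induction List.finRange d with
  | nil => rfl
  | cons j l ih => simp

/-- `mderiv` applies the partial derivatives in a fixed order. An extra derivative in direction `i`
is carried by symmetry of second derivatives to the single place where `i` occurs in the list. This
makes induction on multi-indices possible. -/
theorem foldr_pderiv_add_single {d : ℕ} {f : E d → ℝ} (hf : ContDiff ℝ ∞ f) (γ : Fin d → ℕ)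
    (i : Fin d) (l : List (Fin d)) (hl : l.Nodup) (hi : i ∈ l) :
    l.foldr (fun j g => (pderiv j)^[(γ + Pi.single i 1 : Fin d → ℕ) j] g) f =
      pderiv i (l.foldr (fun j g => (pderiv j)^[γ j] g) f) := by
  induction l with
  | nil => simp at hi
  | cons j l ih =>
    rw [List.nodup_cons] at hl
    simp only [List.foldr_cons]
    by_cases hj : i = j
    · subst hj
      have hfold : l.foldr (fun j g => (pderiv j)^[(γ + Pi.single i 1 : Fin d → ℕ) j] g) f =
          l.foldr (fun j g => (pderiv j)^[γ j] g) f := by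
        refine List.foldr_ext _ _ _ fun a ha b => ?_
        have : a ≠ i := fun h => hl.1 (h ▸ ha)
        simp [this]
      rw [hfold]
      simp [Function.iterate_succ_apply']
    · have hil : i ∈ l := by simpa [hj] using hi
      rw [ih hl.2 hil, pderiv_iterate_comm (contDiff_foldr_pderiv hf γ l)]
      simp [Ne.symm hj]

theorem mderiv_add_single {d : ℕ} {f : E d → ℝ} (hf : ContDiff ℝ ∞ f) (γ : Fin d → ℕ)
    (i : Fin d) : mderiv (γ + Pi.single i 1) f = pderiv i (mderiv γ f) :=
  foldr_pderiv_add_single hf γ i _ (List.nodup_finRange d) (List.mem_finRange i)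

theorem mderiv_add {d : ℕ} {f g : E d → ℝ} (hf : ContDiff ℝ ∞ f) (hg : ContDiff ℝ ∞ g)
    (γ : Fin d → ℕ) : mderiv γ (f + g) = mderiv γ f + mderiv γ g := by
  induction γ using multiIndex_induction with
  | zero => simp
  | step γ i ih =>
    rw [mderiv_add_single (f := f + g) (hf.add hg), ih, pderiv_add (contDiff_mderiv hf γ) (contDiff_mderiv hg γ),
      mderiv_add_single hf, mderiv_add_single hg]

theorem mderiv_smul {d : ℕ} {f : E d → ℝ} (hf : ContDiff ℝ ∞ f) (c : ℝ) (γ : Fin d → ℕ) :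
    mderiv γ (c • f) = c • mderiv γ f := by
  induction γ using multiIndex_induction with
  | zero => simp
  | step γ i ih =>
    rw [mderiv_add_single (f := c • f) (hf.const_smul c), ih, pderiv_smul (contDiff_mderiv hf γ),
      mderiv_add_single hf]

theorem pderiv_congr {d : ℕ} {f g : E d → ℝ} {x : E d} (h : f =ᶠ[𝓝 x] g) (j : Fin d) :
    pderiv j f =ᶠ[𝓝 x] pderiv j g :=
  (h.fderiv (𝕜 := ℝ)).mono fun y hy => by simp [pderiv, hy]

theorem mderiv_congr {d : ℕ} {f g : E d → ℝ} {x : E d} (hf : ContDiff ℝ ∞ f)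
    (hg : ContDiff ℝ ∞ g) (h : f =ᶠ[𝓝 x] g) (γ : Fin d → ℕ) :
    mderiv γ f =ᶠ[𝓝 x] mderiv γ g := by
  induction γ using multiIndex_induction with
  | zero => simpa using h
  | step γ i ih =>
    rw [mderiv_add_single hf, mderiv_add_single hg]
    exact pderiv_congr ih i

theorem pderiv_comp_affine {d : ℕ} {f : E d → ℝ} (hf : ContDiff ℝ ∞ f) (c : ℝ) (a : E d)
    (j : Fin d) : pderiv j (fun x => f (c • (x - a))) = fun x => c * pderiv j f (c • (x - a)) := by
  ext x
  have h1 : HasFDerivAt (fun x : E d => c • (x - a)) (c • ContinuousLinearMap.id ℝ (E d)) x :=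
    ((hasFDerivAt_id x).sub_const a).const_smul c
  have h2 := ((differentiable_of_smooth hf (c • (x - a))).hasFDerivAt).comp x h1
  unfold pderiv
  rw [show (fun x => f (c • (x - a))) = f ∘ fun x => c • (x - a) from rfl, h2.fderiv]
  simp

theorem contDiff_comp_affine {d : ℕ} {f : E d → ℝ} (hf : ContDiff ℝ ∞ f) (c : ℝ) (a : E d) :
    ContDiff ℝ ∞ fun x => f (c • (x - a)) :=
  hf.comp ((contDiff_id.sub contDiff_const).const_smul c)

theorem mderiv_comp_affine {d : ℕ} {f : E d → ℝ} (hf : ContDiff ℝ ∞ f) (c : ℝ) (a : E d)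
    (γ : Fin d → ℕ) : mderiv γ (fun x => f (c • (x - a))) =
      fun x => c ^ (∑ j, γ j) * mderiv γ f (c • (x - a)) := by
  induction γ using multiIndex_induction with
  | zero => simp
  | step γ i ih =>
    have h := contDiff_comp_affine (contDiff_mderiv hf γ) c a
    rw [mderiv_add_single (contDiff_comp_affine hf c a), ih,
      show (fun x => c ^ (∑ j, γ j) * mderiv γ f (c • (x - a))) =
        c ^ (∑ j, γ j) • fun x => mderiv γ f (c • (x - a)) from rfl,
      pderiv_smul h, pderiv_comp_affine (contDiff_mderiv hf γ), mderiv_add_single hf]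
    ext x
    simp [Finset.sum_add_distrib, pow_succ]
    ring

/-! ### Monomials and test functions dual to the derivatives at a point. -/

theorem contDiff_prod_eval {d : ℕ} (p : Fin d → Polynomial ℝ) :
    ContDiff ℝ ∞ fun x : E d => ∏ i, (p i).eval (x i) :=
  contDiff_prod fun i _ => by
    have h := (Polynomial.contDiff_aeval (𝕜 := ℝ) (p i) ∞).comp
      (EuclideanSpace.proj i : E d →L[ℝ] ℝ).contDiff
    simpa [Function.comp_def] using h

theorem pderiv_prod_eval {d : ℕ} (p : Fin d → Polynomial ℝ) (j : Fin d) :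
    pderiv j (fun x : E d => ∏ i, (p i).eval (x i)) = fun x =>
      ∏ i, (Function.update p j (Polynomial.derivative (p j)) i).eval (x i) := by
  ext x
  have h1 : ∀ i ∈ (Finset.univ : Finset (Fin d)), HasFDerivAt (fun x : E d => (p i).eval (x i))
      ((Polynomial.derivative (p i)).eval (x i) • (EuclideanSpace.proj i : E d →L[ℝ] ℝ)) x :=
    fun i _ => HasDerivAt.comp_hasFDerivAt (f := fun x : E d => x i) x ((p i).hasDerivAt (x i))
      (EuclideanSpace.proj i : E d →L[ℝ] ℝ).hasFDerivAt
  unfold pderiv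
  rw [(HasFDerivAt.finsetProd h1).fderiv]
  have hproj : ∀ i : Fin d, (EuclideanSpace.proj i : E d →L[ℝ] ℝ) (EuclideanSpace.single j 1) =
      if i = j then 1 else 0 := fun i => PiLp.single_apply 2 ℝ j 1 i
  simp only [FunLike.coe_sum, Finset.sum_apply, smul_apply, hproj, smul_eq_mul]
  rw [Finset.sum_eq_single j, ← Finset.mul_prod_erase _ _ (Finset.mem_univ j)]
  · simp only [Function.update_self, if_true, mul_one]
    rw [mul_comm]
    congr 1
    refine Finset.prod_congr rfl fun i hi => ?_
    rw [Function.update_of_ne (Finset.ne_of_mem_erase hi)]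
  · intro i _ hi
    simp [hi]
  · simp

theorem mderiv_prod_eval {d : ℕ} (p : Fin d → Polynomial ℝ) (γ : Fin d → ℕ) :
    mderiv γ (fun x : E d => ∏ i, (p i).eval (x i)) = fun x =>
      ∏ i, (Polynomial.derivative^[γ i] (p i)).eval (x i) := by
  induction γ using multiIndex_induction with
  | zero => simp
  | step γ j ih =>
    rw [mderiv_add_single (contDiff_prod_eval p), ih, pderiv_prod_eval]
    ext x
    refine Finset.prod_congr rfl fun i _ => ?_
    rcases eq_or_ne i j with rfl | hij
    · simp [Function.iterate_succ_apply']
    · simp [hij]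

theorem eval_zero_iterate_derivative_monomial (m n : ℕ) :
    (Polynomial.derivative^[m] (Polynomial.C ((n.factorial : ℝ)⁻¹) * Polynomial.X ^ n)).eval 0 =
      if m = n then 1 else 0 := by
  rw [Polynomial.iterate_derivative_C_mul, Polynomial.iterate_derivative_X_pow_eq_C_mul]
  split_ifs with h
  · subst h
    simp [Nat.descFactorial_self, Nat.factorial_ne_zero]
  · rcases lt_or_gt_of_ne h with h | h
    · simp [Nat.sub_ne_zero_of_lt h]
    · simp [Nat.descFactorial_of_lt h]

/-- The Taylor monomial `x^γ / γ!` has the required derivatives at `0`. A cutoff equal to `1` near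
`0` makes it a test function without changing them. -/
theorem exists_test_dual_mderiv {d : ℕ} (γ : Fin d → ℕ) :
    ∃ ψ : E d → ℝ, IsTest (Metric.ball 0 1) ψ ∧
      ∀ β : Fin d → ℕ, mderiv β ψ 0 = if β = γ then 1 else 0 := by
  let η : ContDiffBump (0 : E d) := ⟨1 / 4, 1 / 2, by norm_num, by norm_num⟩
  let p : Fin d → Polynomial ℝ := fun i =>
    Polynomial.C (((γ i).factorial : ℝ)⁻¹) * Polynomial.X ^ (γ i)
  have hη : ContDiff ℝ ∞ (fun x => η x * ∏ i, (p i).eval (x i)) :=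
    η.contDiff.mul (contDiff_prod_eval p)
  have hsub : tsupport (fun x => η x * ∏ i, (p i).eval (x i)) ⊆ tsupport η :=
    tsupport_mul_subset_left
  refine ⟨fun x => η x * ∏ i, (p i).eval (x i), ⟨hη, ?_, ?_⟩, fun β => ?_⟩
  · exact η.hasCompactSupport.mul_right
  · refine hsub.trans ?_
    rw [η.tsupport_eq]
    exact Metric.closedBall_subset_ball (by norm_num [η])
  · have h : (fun x => η x * ∏ i, (p i).eval (x i)) =ᶠ[𝓝 0] fun x => ∏ i, (p i).eval (x i) :=
      η.eventuallyEq_one.mono fun x hx => by simp [hx]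
    rw [(mderiv_congr hη (contDiff_prod_eval p) h β).eq_of_nhds, mderiv_prod_eval]
    simp only [PiLp.zero_apply, p, eval_zero_iterate_derivative_monomial]
    rw [Finset.prod_ite_zero]
    simp [funext_iff]

/-- Integration by parts. -/
theorem integral_mderiv_mul {d : ℕ} {S S' : Set (E d)} {f g : E d → ℝ} (hf : IsTest S f)
    (hg : IsTest S' g) (γ : Fin d → ℕ) :
    ∫ x, mderiv γ f x * g x = (-1) ^ (∑ j, γ j) * ∫ x, f x * mderiv γ g x := by
  induction γ using multiIndex_induction generalizing g with
  | zero => simp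
  | step γ i ih =>
    have hF := hf.mderiv γ
    have h1 : ∫ x, mderiv γ f x * pderiv i g x = - ∫ x, pderiv i (mderiv γ f) x * g x := by
      have hc : ∀ {u v : E d → ℝ}, Continuous u → Continuous v → HasCompactSupport v →
          Integrable (fun x => u x * v x) := fun hu hv hv' =>
        (hu.mul hv).integrable_of_hasCompactSupport hv'.mul_left
      refine integral_mul_fderiv_eq_neg_fderiv_mul_of_integrable
        (𝕜 := ℝ) (f := mderiv γ f) (g := g) (v := EuclideanSpace.single i 1) ?_ ?_ ?_ ?_ ?_
      · exact hc (hF.pderiv i).smooth.continuous hg.smooth.continuous hg.compact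
      · exact hc hF.smooth.continuous (hg.pderiv i).smooth.continuous (hg.pderiv i).compact
      · exact hc hF.smooth.continuous hg.smooth.continuous hg.compact
      · exact fun x _ => differentiable_of_smooth hF.smooth x
      · exact fun x _ => differentiable_of_smooth hg.smooth x
    rw [mderiv_add_single hf.smooth, mderiv_add_single hg.smooth]
    have h2 := ih (hg.pderiv i)
    have h3 : mderiv γ (pderiv i g) = pderiv i (mderiv γ g) := by
      clear h1 h2 ih hF
      induction γ using multiIndex_induction with
      | zero => simp
      | step γ k ih =>
        rw [mderiv_add_single (hg.pderiv i).smooth, ih, mderiv_add_single hg.smooth,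
          pderiv_comm (contDiff_mderiv hg.smooth γ)]
    rw [h3] at h2
    rw [← neg_eq_iff_eq_neg.2 h1, h2]
    simp [Finset.sum_add_distrib, pow_succ]

/-! ### A Sobolev inequality on balls -/

theorem fderiv_eq_sum_pderiv {d : ℕ} (g : E d → ℝ) (z v : E d) :
    fderiv ℝ g z v = ∑ i, v i * pderiv i g z := by
  conv_lhs => rw [← (EuclideanSpace.basisFun (Fin d) ℝ).sum_repr v]
  simp [pderiv, map_sum]

/-- Each directional derivative is a sum of `d` partial derivatives with coefficients of modulus at
most `1`, whence the factor `d ^ j`. -/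
theorem abs_iteratedFDeriv_mderiv_le {d s : ℕ} {f : E d → ℝ} (hf : ContDiff ℝ ∞ f) (z v : E d)
    (hv : ‖v‖ ≤ 1) (j : ℕ) (γ : Fin d → ℕ) (hj : (∑ i, γ i) + j ≤ s) :
    |iteratedFDeriv ℝ j (mderiv γ f) z (fun _ => v)| ≤
      (d : ℝ) ^ j * ∑ β : MultiIndex d s, |mderiv β.1 f z| := by
  induction j generalizing γ with
  | zero =>
    let β₀ : MultiIndex d s := ⟨γ, by simpa using hj⟩
    have h := Finset.single_le_sum (f := fun β : MultiIndex d s => |mderiv β.1 f z|)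
      (fun _ _ => abs_nonneg _) (Finset.mem_univ β₀)
    simpa [β₀] using h
  | succ j ih =>
    have hg := contDiff_mderiv hf γ
    have h1 : iteratedFDeriv ℝ (j + 1) (mderiv γ f) z (fun _ => v) =
        ∑ i, v i * iteratedFDeriv ℝ j (mderiv (γ + Pi.single i 1) f) z (fun _ => v) := by
      rw [iteratedFDeriv_succ_apply_right]
      have h2 := iteratedFDeriv_clm_apply_const_apply (𝕜 := ℝ) (n := ∞) (i := j) (x := z) (u := v)
        (m := fun _ => v) (hg.fderiv_right (m := ∞) (by simp)) (by exact_mod_cast le_top)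
      have h3 : (fun y => fderiv ℝ (mderiv γ f) y v) =
          fun y => ∑ i, (v i • mderiv (γ + Pi.single i 1) f) y := by
        ext y
        rw [fderiv_eq_sum_pderiv]
        simp [mderiv_add_single hf]
      have hs : ∀ i : Fin d, ContDiff ℝ j (mderiv (γ + Pi.single i 1) f) := fun i =>
        (contDiff_mderiv hf _).of_le (by exact_mod_cast le_top)
      refine Eq.trans h2.symm ?_
      rw [h3, iteratedFDeriv_fun_sum_apply (f := fun i => v i • mderiv (γ + Pi.single i 1) f) fun i _ => ((hs i).const_smul (v i)).contDiffAt]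
      simp only [sum_apply]
      refine Finset.sum_congr rfl fun i _ => ?_
      rw [iteratedFDeriv_const_smul_apply (hs i).contDiffAt]
      simp
    rw [h1]
    refine (Finset.abs_sum_le_sum_abs _ _).trans ?_
    calc ∑ i, |v i * iteratedFDeriv ℝ j (mderiv (γ + Pi.single i 1) f) z (fun _ => v)|
        ≤ ∑ _i : Fin d, (d : ℝ) ^ j * ∑ β : MultiIndex d s, |mderiv β.1 f z| := by
          refine Finset.sum_le_sum fun i _ => ?_
          rw [abs_mul]
          have hvi : |v i| ≤ 1 := (PiLp.norm_apply_le v i).trans hv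
          refine (mul_le_of_le_one_left (abs_nonneg _) hvi).trans (ih _ ?_)
          simp [Finset.sum_add_distrib]
          omega
      _ = _ := by simp [pow_succ]; ring

theorem hasDerivAt_iteratedFDeriv_line {d : ℕ} {g : E d → ℝ} (hg : ContDiff ℝ ∞ g) (x v : E d)
    (j : ℕ) (t : ℝ) :
    HasDerivAt (fun t : ℝ => iteratedFDeriv ℝ j g (x + t • v) (fun _ => v))
      (iteratedFDeriv ℝ (j + 1) g (x + t • v) (fun _ => v)) t := by
  have h1 : HasDerivAt (fun t : ℝ => x + t • v) v t := by
    simpa using ((hasDerivAt_id t).smul_const v).const_add x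
  have h2 : HasFDerivAt (iteratedFDeriv ℝ j g) (fderiv ℝ (iteratedFDeriv ℝ j g) (x + t • v))
      (x + t • v) :=
    ((hg.differentiable_iteratedFDeriv (by exact_mod_cast ENat.natCast_lt_top j)) _).hasFDerivAt
  have h3 := (ContinuousMultilinearMap.apply ℝ (fun _ : Fin j => E d) ℝ
    (fun _ => v)).hasFDerivAt.comp_hasDerivAt t (h2.comp_hasDerivAt t h1)
  rw [iteratedFDeriv_succ_apply_left]
  exact h3

theorem hasDerivAt_setIntegral_ball {d : ℕ} {F F' : ℝ → E d → ℝ}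
    (hF : Continuous fun p : ℝ × E d => F p.1 p.2)
    (hF' : Continuous fun p : ℝ × E d => F' p.1 p.2)
    (hd : ∀ t y, HasDerivAt (fun t => F t y) (F' t y) t) (t : ℝ) :
    HasDerivAt (fun t => ∫ y in Metric.ball 0 1, F t y) (∫ y in Metric.ball 0 1, F' t y) t := by
  have hc : IsCompact (Metric.closedBall t 1 ×ˢ Metric.closedBall (0 : E d) 1) :=
    (isCompact_closedBall t 1).prod (isCompact_closedBall 0 1)
  obtain ⟨C, hC⟩ := hc.exists_bound_of_continuousOn hF'.continuousOn
  have hF1 : ∀ t, Continuous (F t) := fun t => hF.comp (by fun_prop : Continuous fun y => (t, y))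
  have hF1' : ∀ t, Continuous (F' t) :=
    fun t => hF'.comp (by fun_prop : Continuous fun y => (t, y))
  refine (hasDerivAt_integral_of_dominated_loc_of_deriv_le (bound := fun _ => C)
    (Metric.closedBall_mem_nhds t one_pos) ?_ ?_ ?_ ?_ ?_ ?_).2
  · exact Filter.Eventually.of_forall fun t => (hF1 t).aestronglyMeasurable
  · exact ((hF1 t).continuousOn.integrableOn_compact (isCompact_closedBall 0 1)).mono_set
      Metric.ball_subset_closedBall
  · exact (hF1' t).aestronglyMeasurable
  · refine (ae_restrict_iff' measurableSet_ball).2 (Filter.Eventually.of_forall ?_)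
    exact fun y hy u hu => hC (u, y) ⟨hu, Metric.ball_subset_closedBall hy⟩
  · exact integrableOn_const (by exact measure_ball_lt_top.ne)
  · exact Filter.Eventually.of_forall fun y u _ => hd u y

theorem setIntegral_ball_comp_affine {d : ℕ} (F : E d → ℝ) (x : E d) {ρ : ℝ} (hρ : 0 < ρ) :
    ∫ y in Metric.ball 0 1, F (x + ρ • y) = (ρ ^ d)⁻¹ * ∫ z in Metric.ball x ρ, F z := by
  have h1 := Measure.setIntegral_comp_smul_of_pos (volume : Measure (E d)) (fun z => F (x + z))
    (Metric.ball 0 1) hρ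
  rw [h1, finrank_euclideanSpace_fin, smul_eq_mul, smul_unitBall_of_pos hρ]
  congr 1
  have h2 := (measurePreserving_add_left (volume : Measure (E d)) x).setIntegral_preimage_emb
    (MeasurableEquiv.addLeft x).measurableEmbedding F (Metric.ball x ρ)
  rw [← h2]
  congr 2
  ext z
  simp

/-- Cauchy–Schwarz against the constant `1`: the integral of `(|F| - c)²` is nonnegative for every
`c`, in particular for the mean of `|F|`. -/
theorem sq_integral_abs_le {α : Type*} [MeasurableSpace α] {μ : Measure α} [IsFiniteMeasure μ]
    {F : α → ℝ} (hF : Integrable F μ) (hF2 : Integrable (fun a => F a ^ 2) μ) :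
    (∫ a, |F a| ∂μ) ^ 2 ≤ μ.real univ * ∫ a, F a ^ 2 ∂μ := by
  set A := ∫ a, |F a| ∂μ
  set V := μ.real univ
  have h : ∀ c : ℝ, 0 ≤ (∫ a, F a ^ 2 ∂μ) - 2 * c * A + c ^ 2 * V := fun c => by
    have h1 : ∫ a, (|F a| - c) ^ 2 ∂μ = (∫ a, F a ^ 2 ∂μ) - 2 * c * A + c ^ 2 * V := by
      have h2 : ∀ a, (|F a| - c) ^ 2 = F a ^ 2 - (2 * c) * |F a| + c ^ 2 := fun a => by
        rw [sub_sq, sq_abs]; ring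
      simp_rw [h2]
      have h3 : Integrable (fun a => (2 * c) * |F a|) μ := hF.abs.const_mul _
      have h4 : Integrable (fun a => F a ^ 2 - (2 * c) * |F a|) μ := hF2.sub h3
      rw [integral_add h4 (integrable_const _), integral_sub hF2 h3, integral_const_mul, integral_const, smul_eq_mul,
        mul_comm (c ^ 2)]
    exact h1 ▸ integral_nonneg fun a => sq_nonneg _
  rcases (measureReal_nonneg : 0 ≤ V).eq_or_lt with hV | hV
  · have hμ : μ = 0 := by
      rw [← Measure.measure_univ_eq_zero]
      exact (measureReal_eq_zero_iff).1 hV.symm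
    simp [A, hμ]
  · have := h (A / V)
    have e : (∫ a, F a ^ 2 ∂μ) - 2 * (A / V) * A + (A / V) ^ 2 * V =
        (∫ a, F a ^ 2 ∂μ) - A ^ 2 / V := by field_simp; ring
    rw [e, sub_nonneg, div_le_iff₀ hV] at this
    linarith

/-- Taylor's formula at `0` from the base point `1`. The remainder is the integral of `t^n / n! · Φ
(n+1) t` up to sign, and the singularity `t^(n-a)` is integrable exactly because `a < n + 1`. -/
theorem abs_le_of_hasDerivAt_of_le_rpow {Φ : ℕ → ℝ → ℝ}
    (hΦ : ∀ j t, HasDerivAt (Φ j) (Φ (j + 1) t) t) {n : ℕ} {B a : ℝ}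
    (hbd : ∀ j ≤ n + 1, ∀ t ∈ Ioc (0 : ℝ) 1, |Φ j t| ≤ B * t ^ (-a)) (ha : a < n + 1) :
    |Φ 0 0| ≤ B * (n + 1 + (n + 1 - a)⁻¹) := by
  set p : ℝ := n + 1 - a
  have hp : 0 < p := sub_pos.2 ha
  -- The degree `k` Taylor polynomial based at `t`, evaluated at `0`. Its derivative in `t`
  -- telescopes to a single term.
  let Ψ : ℕ → ℝ → ℝ := fun k t => ∑ j ∈ Finset.range (k + 1), (-t) ^ j / j.factorial * Φ j t
  have hΨ : ∀ k t, HasDerivAt (Ψ k) ((-t) ^ k / k.factorial * Φ (k + 1) t) t := by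
    intro k t
    induction k with
    | zero => simpa [Ψ] using hΦ 0 t
    | succ k ih =>
      have h1 : Ψ (k + 1) = Ψ k + fun t => (-t) ^ (k + 1) / (k + 1).factorial * Φ (k + 1) t := by
        ext t
        simp only [Ψ, Pi.add_apply]
        rw [Finset.sum_range_succ]
      rw [h1]
      have h2 : HasDerivAt (fun t : ℝ => (-t) ^ (k + 1) / ((k + 1).factorial : ℝ))
          (-((-t) ^ k / k.factorial)) t := by
        have h3 := (((hasDerivAt_id t).neg).pow (k + 1)).div_const ((k + 1).factorial : ℝ)
        refine h3.congr_deriv ?_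
        have : (k.factorial : ℝ) ≠ 0 := by positivity
        simp [Nat.factorial_succ]
        field_simp
      refine (ih.add (h2.mul (hΦ (k + 1) t))).congr_deriv ?_
      ring
  have h0 : Ψ n 0 = Φ 0 0 := by
    simp only [Ψ]
    rw [Finset.sum_range_succ']
    simp
  have h1 : |Ψ n 1| ≤ B * (n + 1) := by
    simp only [Ψ]
    refine (Finset.abs_sum_le_sum_abs _ _).trans ?_
    have : ∀ j ∈ Finset.range (n + 1), |(-1 : ℝ) ^ j / j.factorial * Φ j 1| ≤ B := by
      intro j hj
      rw [abs_mul, abs_div, abs_pow, abs_neg, abs_one, one_pow, Nat.abs_cast]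
      have hle := hbd j (by have := Finset.mem_range.1 hj; omega) 1 ⟨one_pos, le_rfl⟩
      rw [Real.one_rpow, mul_one] at hle
      refine (mul_le_of_le_one_left (abs_nonneg _) ?_).trans hle
      exact div_le_one_of_le₀ (by exact_mod_cast Nat.factorial_pos j) (by positivity)
    refine (Finset.sum_le_sum this).trans ?_
    simp [mul_comm]
  -- Monotonicity replaces integration of the remainder. Derivatives are needed only in the open
  -- interval, so it is harmless that `t ^ (p - 1)` may blow up at `0`.
  have hcmp : ∀ σ : ℝ, |σ| = 1 → MonotoneOn (fun t => B * t ^ p / p - σ * Ψ n t) (Icc 0 1) := by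
    intro σ hσ
    refine monotoneOn_of_hasDerivWithinAt_nonneg (convex_Icc 0 1)
      (f' := fun t => B * t ^ (p - 1) - σ * ((-t) ^ n / n.factorial * Φ (n + 1) t)) ?_ ?_ ?_
    · refine ContinuousOn.sub ?_ ?_
      · exact ((continuous_id.rpow_const fun _ => Or.inr hp.le).const_mul B |>.div_const p).continuousOn
      · exact (continuous_iff_continuousAt.2 fun t => (hΨ n t).continuousAt).continuousOn.const_mul σ
    · intro t ht
      rw [interior_Icc] at ht
      have h2 := ((Real.hasDerivAt_rpow_const (p := p) (Or.inl ht.1.ne')).const_mul B).div_const p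
      refine ((h2.congr_deriv ?_).sub ((hΨ n t).const_mul σ)).hasDerivWithinAt
      field_simp
    · intro t ht
      rw [interior_Icc] at ht
      have h3 : |σ * ((-t) ^ n / n.factorial * Φ (n + 1) t)| ≤ B * t ^ (p - 1) := by
        rw [abs_mul, hσ, one_mul, abs_mul, abs_div, abs_pow, abs_neg, abs_of_pos ht.1, Nat.abs_cast]
        have h4 : t ^ n / (n.factorial : ℝ) ≤ t ^ n := by
          refine div_le_self (by have := ht.1.le; positivity) ?_
          exact_mod_cast Nat.factorial_pos n
        calc _ ≤ t ^ n * (B * t ^ (-a)) :=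
              mul_le_mul h4 (hbd _ le_rfl t ⟨ht.1, ht.2.le⟩) (abs_nonneg _) (by
                have := ht.1.le; positivity)
          _ = B * t ^ (p - 1) := by
              rw [show p - 1 = (n : ℝ) + -a by simp only [p]; ring, Real.rpow_add ht.1,
                Real.rpow_natCast]
              ring
      linarith [(abs_le.1 h3).2]
  have h4 : ∀ σ : ℝ, |σ| = 1 → σ * (Ψ n 1 - Ψ n 0) ≤ B / p := by
    intro σ hσ
    have := hcmp σ hσ (left_mem_Icc.2 zero_le_one) (right_mem_Icc.2 zero_le_one) zero_le_one
    simp only [Real.zero_rpow hp.ne', Real.one_rpow] at this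
    have e : B * 0 / p = 0 := by simp
    rw [e] at this
    linarith [mul_one B ▸ this]
  rw [← h0]
  have h5 := h4 1 (by simp)
  have h6 := h4 (-1) (by simp)
  have h7 := abs_le.1 h1
  rw [mul_add, ← div_eq_mul_inv]
  exact abs_le.2 ⟨by linarith, by linarith⟩

/-- The square of the norm of `H^s(B)` for the ball `B` of center `x` and radius `r`. -/
def ballNormSq {d : ℕ} (s : ℕ) (f : E d → ℝ) (x : E d) (r : ℝ) : ℝ :=
  ∑ β : MultiIndex d s, ∫ z in Metric.ball x r, mderiv β.1 f z ^ 2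

theorem integrableOn_ball {d : ℕ} {F : E d → ℝ} (hF : Continuous F) (x : E d) (r : ℝ) :
    IntegrableOn F (Metric.ball x r) :=
  (hF.continuousOn.integrableOn_compact (isCompact_closedBall x r)).mono_set
    Metric.ball_subset_closedBall

/-- Cauchy–Schwarz and the change of variables `z = x + t r y` produce `(t r)^{-d}` under the square
root. This is the source of the singularity `t^{-d/2}` in the Sobolev inequality. -/
theorem setIntegral_abs_ball_le {d : ℕ} {F : E d → ℝ} (hF : Continuous F) (x : E d) {r t : ℝ}
    (hr : 0 < r) (ht : t ∈ Ioc (0 : ℝ) 1) {S : ℝ} (hS : ∫ z in Metric.ball x r, F z ^ 2 ≤ S) :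
    ∫ y in Metric.ball 0 1, |F (x + (t * r) • y)| ≤
      √(volume.real (Metric.ball (0 : E d) 1) * ((r ^ d)⁻¹ * S)) * t ^ (-(d : ℝ) / 2) := by
  have hρ : 0 < t * r := mul_pos ht.1 hr
  have hG : Continuous fun y => F (x + (t * r) • y) := by fun_prop
  have : IsFiniteMeasure (volume.restrict (Metric.ball (0 : E d) 1)) :=
    isFiniteMeasure_restrict.2 measure_ball_lt_top.ne
  have h1 := sq_integral_abs_le (integrableOn_ball hG 0 1) (integrableOn_ball (hG.pow 2) 0 1)
  rw [setIntegral_ball_comp_affine (fun z => F z ^ 2) x hρ, measureReal_restrict_apply_univ] at h1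
  have h2 : ∫ z in Metric.ball x (t * r), F z ^ 2 ≤ S :=
    (setIntegral_mono_set (integrableOn_ball (hF.pow 2) x r)
      (Filter.Eventually.of_forall fun z => sq_nonneg _)
      (Metric.ball_subset_ball (mul_le_of_le_one_left hr.le ht.2)).eventuallyLE).trans hS
  have h3 : (t ^ (-(d : ℝ) / 2)) ^ 2 = (t ^ d)⁻¹ := by
    rw [← Real.rpow_natCast, ← Real.rpow_mul ht.1.le, ← Real.rpow_natCast, ← Real.rpow_neg ht.1.le]
    congr 1
    push_cast
    ring
  have hS0 : 0 ≤ S := (integral_nonneg fun z => sq_nonneg _).trans hS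
  refine abs_le_of_sq_le_sq' ?_ (mul_nonneg (Real.sqrt_nonneg _) (Real.rpow_nonneg ht.1.le _)) |>.2
  rw [mul_pow, Real.sq_sqrt (by positivity), h3]
  refine h1.trans ?_
  calc _ ≤ volume.real (Metric.ball (0 : E d) 1) * (((t * r) ^ d)⁻¹ * S) := by gcongr
    _ = _ := by rw [mul_pow, mul_inv]; ring

/-- A Sobolev inequality with the scaling in the radius of the ball. -/
theorem exists_sobolev_ball {d s J : ℕ} (hJ : (J : ℝ) < (s : ℝ) - (d : ℝ) / 2) :
    ∃ C : ℝ, 0 < C ∧ ∀ (f : E d → ℝ), ContDiff ℝ ∞ f → ∀ (x : E d) (r : ℝ), 0 < r → r ≤ 1 →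
      ∀ γ : Fin d → ℕ, ∑ i, γ i ≤ J →
      mderiv γ f x ^ 2 ≤ C * (r ^ d)⁻¹ * ballNormSq s f x r := by
  have hJs : J < s := by
    have : (J : ℝ) < s := by linarith [(Nat.cast_nonneg d : (0 : ℝ) ≤ d)]
    exact_mod_cast this
  -- With `n + 1 = s - J`, the derivatives of `mderiv γ f` up to order `n + 1` have total order at
  -- most `s`, and the hypothesis `hJ` becomes `d / 2 < n + 1`.
  obtain ⟨n, hn⟩ : ∃ n, s = J + (n + 1) := ⟨s - J - 1, by omega⟩
  set V := volume.real (Metric.ball (0 : E d) 1)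
  have hV : 0 < V := ENNReal.toReal_pos (Metric.measure_ball_pos _ _ one_pos).ne'
    measure_ball_lt_top.ne
  set a : ℝ := (d : ℝ) / 2
  have ha : a < n + 1 := by
    rw [hn] at hJ; push_cast at hJ; linarith
  set M : ℝ := ((Fintype.card (MultiIndex d s) : ℕ) : ℝ)
  set A : ℝ := ((d : ℝ) + 1) ^ s * M * (n + 1 + (n + 1 - a)⁻¹)
  have hA : 0 ≤ A := by
    have : 0 < (n + 1 - a)⁻¹ := inv_pos.2 (sub_pos.2 ha)
    positivity
  refine ⟨A ^ 2 * V⁻¹ + 1, by positivity, fun f hf x r hr hr1 γ hγ => ?_⟩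
  set S := ballNormSq s f x r
  have hSn : ∀ β : MultiIndex d s, 0 ≤ ∫ z in Metric.ball x r, mderiv β.1 f z ^ 2 :=
    fun β => integral_nonneg fun z => sq_nonneg _
  have hS : ∀ β : MultiIndex d s, ∫ z in Metric.ball x r, mderiv β.1 f z ^ 2 ≤ S := fun β =>
    Finset.single_le_sum (f := fun β : MultiIndex d s => ∫ z in Metric.ball x r, mderiv β.1 f z ^ 2)
      (fun β _ => hSn β) (Finset.mem_univ β)
  have hS0 : 0 ≤ S := Finset.sum_nonneg fun β _ => hSn β
  have hg := contDiff_mderiv hf γ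
  -- The derivatives along the segment from `x` to `x + r • y`. Averaging over `y` in the unit ball
  -- gives functions of `t` alone: `Φ 0 0` is the volume times the value at `x`, and `Φ j` for `t >
  -- 0` is controlled by `L²` norms.
  let G : ℕ → ℝ → E d → ℝ := fun j t y =>
    iteratedFDeriv ℝ j (mderiv γ f) (x + t • r • y) (fun _ => r • y)
  have hGc : ∀ j, Continuous fun p : ℝ × E d => G j p.1 p.2 := by
    intro j
    have h1 : Continuous (iteratedFDeriv ℝ j (mderiv γ f)) :=
      hg.continuous_iteratedFDeriv (by exact_mod_cast le_top)
    exact (h1.comp (by fun_prop : Continuous fun p : ℝ × E d => x + p.1 • r • p.2)).eval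
      (by fun_prop : Continuous fun (p : ℝ × E d) (_ : Fin j) => r • p.2)
  let Φ : ℕ → ℝ → ℝ := fun j t => ∫ y in Metric.ball 0 1, G j t y
  have hΦ : ∀ j t, HasDerivAt (Φ j) (Φ (j + 1) t) t := fun j t =>
    hasDerivAt_setIntegral_ball (hGc j) (hGc (j + 1))
      (fun t y => hasDerivAt_iteratedFDeriv_line hg x (r • y) j t) t
  set R := √(V * ((r ^ d)⁻¹ * S))
  have hbd : ∀ j ≤ n + 1, ∀ t ∈ Ioc (0 : ℝ) 1,
      |Φ j t| ≤ (((d : ℝ) + 1) ^ s * M * R) * t ^ (-a) := by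
    intro j hj t ht
    have hGt : Continuous (G j t) := (hGc j).comp (by fun_prop : Continuous fun y : E d => (t, y))
    have hmc : ∀ β : MultiIndex d s, Continuous fun y => |mderiv β.1 f (x + (t * r) • y)| :=
      fun β => ((contDiff_mderiv hf β.1).continuous.comp (by fun_prop)).abs
    calc |Φ j t| ≤ ∫ y in Metric.ball 0 1, |G j t y| := abs_integral_le_integral_abs
      _ ≤ ∫ y in Metric.ball 0 1,
          ((d : ℝ) + 1) ^ s * ∑ β : MultiIndex d s, |mderiv β.1 f (x + (t * r) • y)| := by
        refine setIntegral_mono_on (integrableOn_ball hGt.abs _ _)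
          (integrableOn_ball ((continuous_finsetSum _ fun β _ => hmc β).const_mul _) _ _)
          measurableSet_ball fun y hy => ?_
        have hy1 : ‖r • y‖ ≤ 1 := by
          rw [norm_smul, Real.norm_of_nonneg hr.le]
          exact mul_le_one₀ hr1 (norm_nonneg _) (by simpa using (mem_ball_zero_iff.1 hy).le)
        have h2 := abs_iteratedFDeriv_mderiv_le (s := s) hf (x + t • r • y) (r • y) hy1 j γ
          (by omega)
        rw [smul_smul] at h2
        have h3 : (d : ℝ) ^ j ≤ ((d : ℝ) + 1) ^ s :=
          (pow_le_pow_left₀ (Nat.cast_nonneg d) (by linarith) j).trans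
            (pow_le_pow_right₀ (by linarith [(Nat.cast_nonneg d : (0 : ℝ) ≤ d)]) (by omega))
        simp only [G, smul_smul]
        exact h2.trans (mul_le_mul_of_nonneg_right h3 (Finset.sum_nonneg fun _ _ => abs_nonneg _))
      _ = ((d : ℝ) + 1) ^ s * ∑ β : MultiIndex d s,
          ∫ y in Metric.ball 0 1, |mderiv β.1 f (x + (t * r) • y)| := by
        rw [integral_const_mul, integral_finsetSum _ fun β _ => integrableOn_ball (hmc β) _ _]
      _ ≤ ((d : ℝ) + 1) ^ s * ∑ _β : MultiIndex d s, R * t ^ (-a) := by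
        refine mul_le_mul_of_nonneg_left (Finset.sum_le_sum fun β _ => ?_) (by positivity)
        have := setIntegral_abs_ball_le (contDiff_mderiv hf β.1).continuous x hr ht (hS β)
        rwa [neg_div] at this
      _ = _ := by
        simp only [Finset.sum_const, Finset.card_univ, nsmul_eq_mul]
        ring
  have hmain := abs_le_of_hasDerivAt_of_le_rpow hΦ (n := n) hbd ha
  have h0 : Φ 0 0 = V * mderiv γ f x := by
    simp [Φ, G, V]
  rw [h0, abs_mul, abs_of_pos hV] at hmain
  have h1 : (V * |mderiv γ f x|) ^ 2 ≤ (A * R) ^ 2 := by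
    refine pow_le_pow_left₀ (by positivity) (hmain.trans_eq ?_) 2
    simp only [A]; ring
  rw [mul_pow, sq_abs, mul_pow, Real.sq_sqrt (by positivity)] at h1
  have h2 : mderiv γ f x ^ 2 ≤ A ^ 2 * V⁻¹ * (r ^ d)⁻¹ * S := by
    refine le_of_mul_le_mul_left (h1.trans_eq ?_) (by positivity : 0 < V ^ 2)
    field_simp
  refine h2.trans ?_
  gcongr
  linarith

/-! ### Test functions in `H_0^s` and the Dirac measurements -/

/-- The space `C_0^∞(S)`. -/
def testSubmodule {d : ℕ} (S : Set (E d)) : Submodule ℝ (E d → ℝ) where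
  carrier := {f | IsTest S f}
  add_mem' {f g} hf hg := by
    refine ⟨hf.smooth.add hg.smooth, hf.compact.add hg.compact, ?_⟩
    exact (tsupport_add f g).trans (union_subset hf.subset hg.subset)
  zero_mem' := ⟨contDiff_const, HasCompactSupport.zero, by simp [tsupport]⟩
  smul_mem' c f hf := by
    have hsub : tsupport (c • f) ⊆ tsupport f := tsupport_smul_subset_right (fun _ => c) f
    exact ⟨hf.smooth.const_smul c, hf.compact.mono' (subset_closure.trans hsub),
      hsub.trans hf.subset⟩

/-- The inclusion `C_0^∞(S) ⊆ H_0^s(S)`, as a linear map. -/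
def testToH0 {d : ℕ} (s : ℕ) (S : Set (E d)) : testSubmodule S →ₗ[ℝ] H0 s S where
  toFun f := IsTest.toH0 s f.2
  map_add' f g := by
    refine H0.jet.injective ?_
    rw [map_add]
    refine PiLp.ext fun β => ?_
    have hf := IsTest.memLp (IsTest.mderiv f.2 β.1)
    have hg := IsTest.memLp (IsTest.mderiv g.2 β.1)
    exact (MemLp.toLp_congr (IsTest.memLp (IsTest.mderiv (f + g).2 β.1)) (hf.add hg)
      (Filter.EventuallyEq.of_eq (mderiv_add (IsTest.smooth f.2) (IsTest.smooth g.2) β.1))).trans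
      (MemLp.toLp_add hf hg)
  map_smul' c f := by
    refine H0.jet.injective ?_
    rw [map_smul]
    refine PiLp.ext fun β => ?_
    have hf := IsTest.memLp (IsTest.mderiv f.2 β.1)
    exact (MemLp.toLp_congr (IsTest.memLp (IsTest.mderiv (c • f).2 β.1)) (hf.const_smul c)
      (Filter.EventuallyEq.of_eq (mderiv_smul (IsTest.smooth f.2) c β.1))).trans
      (MemLp.toLp_const_smul c hf)

/-- The test functions already form a subspace, so the span in `H0Sub` adds nothing. -/
theorem denseRange_testToH0 {d : ℕ} (s : ℕ) (S : Set (E d)) : DenseRange (testToH0 s S) := by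
  intro u
  have hspan : Submodule.span ℝ {u | ∃ (f : E d → ℝ) (hf : IsTest S f), u = hf.toJet s} =
      LinearMap.range (H0.jet.toLinearMap ∘ₗ testToH0 s S) := by
    refine le_antisymm (Submodule.span_le.2 ?_) ?_
    · rintro _ ⟨f, hf, rfl⟩
      exact ⟨⟨f, hf⟩, rfl⟩
    · rintro _ ⟨f, rfl⟩
      exact Submodule.subset_span ⟨f.1, f.2, rfl⟩
  have hu : H0.jet u ∈ H0Sub s S := Subtype.mem u
  unfold H0Sub at hu
  rw [hspan] at hu
  change H0.jet u ∈ closure (range fun f => H0.jet (testToH0 s S f)) at hu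
  rw [H0.jet.isometry.isEmbedding.isInducing.closure_eq_preimage_closure_image, ← range_comp]
  exact hu

theorem norm_sq_toH0 {d s : ℕ} {S : Set (E d)} {f : E d → ℝ} (hf : IsTest S f) :
    ‖hf.toH0 s‖ ^ 2 = ∑ β : MultiIndex d s, ∫ z, mderiv β.1 f z ^ 2 := by
  change ‖hf.toJet s‖ ^ 2 = _
  rw [PiLp.norm_sq_eq_of_L2]
  refine Finset.sum_congr rfl fun β _ => ?_
  rw [← real_inner_self_eq_norm_sq, L2.inner_def]
  refine integral_congr_ae ?_
  filter_upwards [MemLp.coeFn_toLp (hf.mderiv β.1).memLp] with z hz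
  change inner ℝ (MemLp.toLp _ (hf.mderiv β.1).memLp z) (MemLp.toLp _ (hf.mderiv β.1).memLp z) = _
  rw [hz]
  simp [sq]

theorem ballNormSq_le_norm_sq {d s : ℕ} {S : Set (E d)} {f : E d → ℝ} (hf : IsTest S f) (x : E d)
    (r : ℝ) : ballNormSq s f x r ≤ ‖hf.toH0 s‖ ^ 2 := by
  rw [norm_sq_toH0]
  refine Finset.sum_le_sum fun β _ => ?_
  have hint : Integrable (fun z => mderiv β.1 f z ^ 2) := (hf.mderiv β.1).memLp.integrable_sq
  exact setIntegral_le_integral hint (Filter.Eventually.of_forall fun z => sq_nonneg _)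

theorem exists_abs_mderiv_le_norm {d s J : ℕ} (hJ : (J : ℝ) < (s : ℝ) - (d : ℝ) / 2) :
    ∃ C : ℝ, ∀ (S : Set (E d)) (f : E d → ℝ) (hf : IsTest S f) (x : E d) (γ : Fin d → ℕ),
      ∑ i, γ i ≤ J → |mderiv γ f x| ≤ C * ‖hf.toH0 s‖ := by
  obtain ⟨C, hC, h⟩ := exists_sobolev_ball hJ
  refine ⟨√C, fun S f hf x γ hγ => ?_⟩
  have h1 := h f hf.smooth x 1 one_pos le_rfl γ hγ
  rw [one_pow, inv_one, mul_one] at h1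
  refine abs_le_of_sq_le_sq ?_ (by positivity)
  rw [mul_pow, Real.sq_sqrt hC.le]
  exact h1.trans (mul_le_mul_of_nonneg_left (ballNormSq_le_norm_sq hf x 1) hC.le)

/-- The Sobolev bound extends `f ↦ D^γ f(x)` continuously from the dense test functions, so the
default value `0` in `diracDeriv` does not occur. -/
theorem diracDeriv_toH0 {d s J : ℕ} (hJ : (J : ℝ) < (s : ℝ) - (d : ℝ) / 2) {Ω : Set (E d)}
    (x : E d) {γ : Fin d → ℕ} (hγ : ∑ i, γ i ≤ J) {f : E d → ℝ} (hf : IsTest Ω f) :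
    diracDeriv s Ω x γ (hf.toH0 s) = mderiv γ f x := by
  have hex : ∃ φ : Hneg s Ω, ∀ (f : E d → ℝ) (hf : IsTest Ω f),
      φ (hf.toH0 s) = mderiv γ f x := by
    obtain ⟨C, hC⟩ := exists_abs_mderiv_le_norm hJ
    let e : testSubmodule Ω →ₗ[ℝ] ℝ :=
      { toFun := fun f => mderiv γ f.1 x
        map_add' := fun f g => by
          simpa using congrFun (mderiv_add (IsTest.smooth f.2) (IsTest.smooth g.2) γ) x
        map_smul' := fun c f => by
          simpa using congrFun (mderiv_smul (IsTest.smooth f.2) c γ) x }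
    refine ⟨e.extendOfNorm (testToH0 s Ω), fun f hf => ?_⟩
    exact LinearMap.extendOfNorm_eq (denseRange_testToH0 s Ω)
      ⟨C, fun g => hC Ω g.1 g.2 x γ hγ⟩ ⟨f, hf⟩
  unfold diracDeriv
  rw [dif_pos hex]
  exact hex.choose_spec f hf

theorem dirac_toH0 {d s : ℕ} (hs : (0 : ℝ) < (s : ℝ) - (d : ℝ) / 2) {Ω : Set (E d)}
    (x : E d) {f : E d → ℝ} (hf : IsTest Ω f) : dirac s Ω x (hf.toH0 s) = f x := by
  have := diracDeriv_toH0 (J := 0) (by simpa using hs) x (γ := 0) (by simp) hf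
  simpa [dirac] using this

/-- Elements of `H0` are families of `L²` functions, and this lemma shows that they are determined
by their point values. Approximating test functions tend to `0` pointwise and are uniformly bounded.
Integrating by parts against a test function moves the derivatives away, and dominated convergence
makes each component of the limit vanish weakly. -/
theorem eq_zero_of_dirac_eq_zero {d s : ℕ} (hs : (0 : ℝ) < (s : ℝ) - (d : ℝ) / 2)
    {Ω : Set (E d)} {u : H0 s Ω} (hu : ∀ x ∈ Ω, dirac s Ω x u = 0) : u = 0 := by
  obtain ⟨v, hv, hvu⟩ := mem_closure_iff_seq_limit.1 (denseRange_testToH0 s Ω u)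
  choose f hf using hv
  obtain rfl : (fun n => testToH0 s Ω (f n)) = v := funext hf
  obtain ⟨C, hC⟩ := exists_abs_mderiv_le_norm (J := 0) (by simpa using hs)
  have hC0 : ∀ n x, |(f n).1 x| ≤ C * ‖testToH0 s Ω (f n)‖ := fun n x => by
    have := hC Ω (f n).1 (f n).2 x 0 (by simp)
    rwa [mderiv_zero] at this
  obtain ⟨R, hR⟩ := (hvu.norm.bddAbove_range)
  have hbd : ∀ n x, |(f n).1 x| ≤ |C| * R := fun n x =>
    (hC0 n x).trans (mul_le_mul (le_abs_self C) (hR ⟨n, rfl⟩) (norm_nonneg _) (abs_nonneg _))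
  have hlim : ∀ x, Filter.Tendsto (fun n => (f n).1 x) Filter.atTop (𝓝 0) := by
    intro x
    by_cases hx : x ∈ Ω
    · have h1 := ((dirac s Ω x).continuous.tendsto u).comp hvu
      rw [hu x hx] at h1
      exact h1.congr fun n => dirac_toH0 hs x (f n).2
    · have h0 : ∀ n, (f n).1 x = 0 := fun n =>
        image_eq_zero_of_notMem_tsupport fun h => hx (IsTest.subset (f n).2 h)
      simp [h0]
  refine H0.jet.injective ?_
  rw [map_zero]
  refine PiLp.ext fun β => ?_
  rw [PiLp.zero_apply, Lp.eq_zero_iff_ae_eq_zero]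
  have hloc : LocallyIntegrable (H0.jet u β : E d → ℝ) volume :=
    (Lp.memLp _).locallyIntegrable (by norm_num)
  refine ae_eq_zero_of_integral_contDiff_smul_eq_zero hloc fun g hg hgc => ?_
  have hgt : IsTest univ g := ⟨hg, hgc, subset_univ _⟩
  have h1 : ∀ w : Lp ℝ 2 (volume : Measure (E d)),
      inner ℝ (hgt.memLp.toLp g) w = ∫ x, g x • w x := fun w => by
    rw [L2.inner_def]
    refine integral_congr_ae ?_
    filter_upwards [MemLp.coeFn_toLp hgt.memLp] with x hx
    rw [hx]
    simp [mul_comm]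
  rw [← h1]
  have h2 : Filter.Tendsto (fun n => inner ℝ (hgt.memLp.toLp g) (H0.jet (testToH0 s Ω (f n)) β))
      Filter.atTop (𝓝 (inner ℝ (hgt.memLp.toLp g) (H0.jet u β))) := by
    have hcont : Continuous fun w : H0 s Ω => inner ℝ (hgt.memLp.toLp g) (H0.jet w β) :=
      continuous_const.inner ((PiLp.continuous_apply 2 _ β).comp H0.jet.continuous)
    exact (hcont.tendsto u).comp hvu
  refine tendsto_nhds_unique h2 ?_
  have h3 : ∀ n, inner ℝ (hgt.memLp.toLp g) (H0.jet (testToH0 s Ω (f n)) β) =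
      (-1) ^ (∑ j, β.1 j) * ∫ x, (f n).1 x * mderiv β.1 g x := fun n => by
    rw [h1, ← integral_mderiv_mul (f n).2 hgt]
    refine integral_congr_ae ?_
    filter_upwards [MemLp.coeFn_toLp (IsTest.mderiv (f n).2 β.1).memLp] with x hx
    change g x • (MemLp.toLp _ (IsTest.mderiv (f n).2 β.1).memLp) x = _
    rw [hx, smul_eq_mul, mul_comm]
  simp_rw [h3]
  have hgβ := hgt.mderiv β.1
  have h4 : Filter.Tendsto (fun n => ∫ x, (f n).1 x * mderiv β.1 g x) Filter.atTop
      (𝓝 (∫ x, 0 * mderiv β.1 g x)) := by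
    refine tendsto_integral_of_dominated_convergence (fun x => |C| * R * |mderiv β.1 g x|)
      (fun n => ?_) ?_ (fun n => ?_) ?_
    · exact ((IsTest.smooth (f n).2).continuous.mul
        hgβ.smooth.continuous).aestronglyMeasurable
    · exact ((hgβ.smooth.continuous.integrable_of_hasCompactSupport hgβ.compact).abs).const_mul _
    · refine Filter.Eventually.of_forall fun x => ?_
      rw [Real.norm_eq_abs, abs_mul]
      exact mul_le_mul_of_nonneg_right (hbd n x) (abs_nonneg _)
    · exact Filter.Eventually.of_forall fun x => (hlim x).mul_const _
  simpa using h4.const_mul ((-1) ^ (∑ j, β.1 j))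

/-- Point values determine the element, so the choice made in `pairing` is immaterial. -/
theorem pairing_eq {d s : ℕ} (hs : (0 : ℝ) < (s : ℝ) - (d : ℝ) / 2) {Ω : Set (E d)} {g : E d → ℝ}
    {u : H0 s Ω} (hu : ∀ x ∈ Ω, dirac s Ω x u = g x) (φ : Hneg s Ω) : pairing g φ = φ u := by
  have hex : ∃ u : H0 s Ω, ∀ x ∈ Ω, dirac s Ω x u = g x := ⟨u, hu⟩
  unfold pairing
  rw [dif_pos hex]
  congr 1
  refine sub_eq_zero.1 (eq_zero_of_dirac_eq_zero hs fun x hx => ?_)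
  rw [map_sub, hex.choose_spec x hx, hu x hx, sub_self]

theorem IsAdmissible.symm_symm {d s : ℕ} {Ω : Set (E d)} {L : H0 s Ω ≃L[ℝ] Hneg s Ω}
    (hL : IsAdmissible L) (φ ψ : Hneg s Ω) : φ (L.symm ψ) = ψ (L.symm φ) := by
  have := hL.symm (L.symm ψ) (L.symm φ)
  simpa using this

/-- By symmetry, `y ↦ K(x, y)` is represented by `L⁻¹ δ_x`. The inner pairing is then a function of
`x` represented by `L⁻¹ φ_n`, which the outer pairing evaluates. -/
theorem kernelMatrix_green {d s : ℕ} (hs : (0 : ℝ) < (s : ℝ) - (d : ℝ) / 2) {Ω : Set (E d)}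
    {L : H0 s Ω ≃L[ℝ] Hneg s Ω} (hL : IsAdmissible L) {ι : Type} (φ : ι → Hneg s Ω) (m n : ι) :
    kernelMatrix (green L) φ m n = φ m (L.symm (φ n)) := by
  have h1 : ∀ x, pairing (fun y => green L x y) (φ n) = φ n (L.symm (dirac s Ω x)) := fun x =>
    pairing_eq hs (fun y _ => hL.symm_symm _ _) _
  simp only [kernelMatrix, Matrix.of_apply, h1]
  exact pairing_eq hs (fun y _ => hL.symm_symm _ _) _

/-! ### Geometry of the partition -/

/-- A domain below a graph has no slits: moving from a boundary point in the direction `ν` leads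
strictly above the graph, hence out of the closure of `Ω`. -/
theorem interior_closure_subset_of_hasLipschitzBoundary {d : ℕ} {Ω : Set (E d)} (ho : IsOpen Ω)
    (hΩ : HasLipschitzBoundary Ω) : interior (closure Ω) ⊆ Ω := by
  intro p hp
  by_contra hpΩ
  have hfr : p ∈ frontier Ω := by
    rw [frontier, ho.interior_eq]
    exact ⟨interior_subset hp, hpΩ⟩
  obtain ⟨ν, hν, r, hr, C, g, hg, h⟩ := hΩ p hfr
  have hp1 : g ((ℝ ∙ ν)ᗮ.orthogonalProjectionOnto p) ≤ inner ℝ ν p :=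
    not_lt.1 fun hlt => hpΩ ((h p (Metric.mem_ball_self hr)).2 hlt)
  have hline : Continuous fun t : ℝ => p + t • ν := by fun_prop
  have hnear : ∀ᶠ t : ℝ in 𝓝[>] 0, p + t • ν ∈ interior (closure Ω) ∩ Metric.ball p r := by
    refine nhdsWithin_le_nhds (hline.continuousAt.eventually_mem ?_)
    simpa using Filter.inter_mem (isOpen_interior.mem_nhds hp) (Metric.ball_mem_nhds p hr)
  obtain ⟨t, ⟨hti, htb⟩, ht⟩ := (hnear.and self_mem_nhdsWithin).exists
  have hproj : (ℝ ∙ ν)ᗮ.orthogonalProjectionOnto (p + t • ν) =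
      (ℝ ∙ ν)ᗮ.orthogonalProjectionOnto p := by
    rw [map_add, map_smul, Submodule.orthogonalProjectionOnto_orthogonal_apply_eq_zero
      (Submodule.mem_span_singleton_self ν), smul_zero, add_zero]
  have hgt : g ((ℝ ∙ ν)ᗮ.orthogonalProjectionOnto (p + t • ν)) < inner ℝ ν (p + t • ν) := by
    have ht0 : 0 < t := ht
    rw [hproj, inner_add_right, inner_smul_right, real_inner_self_eq_norm_sq, hν]
    linarith
  have hopen : IsOpen {x | g ((ℝ ∙ ν)ᗮ.orthogonalProjectionOnto x) < inner ℝ ν x} :=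
    isOpen_lt (hg.continuous.comp (ContinuousLinearMap.continuous _)) (by fun_prop)
  obtain ⟨y, ⟨hy1, hy2⟩, hyΩ⟩ := mem_closure_iff.1 (interior_subset hti) _
    (hopen.inter Metric.isOpen_ball) ⟨hgt, htb⟩
  exact lt_asymm hy1 ((h y hy2).1 hyΩ)

/-- If all test functions in `S` vanished at `x`, so would their limits. A test function that is
nonzero at `x` has an open set of nonvanishing, contained in `S`. -/
theorem mem_nhds_of_dirac_ne_zero {d s : ℕ} (hs : (0 : ℝ) < (s : ℝ) - (d : ℝ) / 2)
    {Ω S : Set (E d)} (hS : S ⊆ Ω) {x : E d} {u : H0 s Ω} (hu : H0.jet u ∈ H0Sub s S)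
    (hx : dirac s Ω x u ≠ 0) : S ∈ 𝓝 x := by
  obtain ⟨f, hf, hfx⟩ : ∃ f, IsTest S f ∧ f x ≠ 0 := by
    by_contra! hall
    let w : H0 s S := (⟨H0.jet u, hu⟩ : H0Sub s S)
    obtain ⟨v, hv, hvw⟩ := mem_closure_iff_seq_limit.1 (denseRange_testToH0 s S w)
    choose f hf using hv
    obtain rfl : (fun n => testToH0 s S (f n)) = v := funext hf
    have hfΩ : ∀ n, IsTest Ω (f n).1 := fun n =>
      ⟨IsTest.smooth (f n).2, IsTest.compact (f n).2, (IsTest.subset (f n).2).trans hS⟩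
    have h1 : Filter.Tendsto (fun n => (hfΩ n).toH0 s) Filter.atTop (𝓝 u) := by
      rw [H0.jet.isometry.isEmbedding.isInducing.tendsto_nhds_iff]
      exact (H0.jet.continuous.tendsto w).comp hvw
    have h2 := ((dirac s Ω x).continuous.tendsto u).comp h1
    refine hx (tendsto_nhds_unique h2 (tendsto_const_nhds.congr fun n => ?_))
    exact ((dirac_toH0 hs x (hfΩ n)).trans (hall _ (f n).2)).symm
  exact Filter.mem_of_superset ((hf.smooth.continuous.isOpen_support).mem_nhds hfx)
    ((subset_tsupport f).trans hf.subset)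

theorem IsPartition.ball_subset {d Q : ℕ} {Ω : Set (E d)} {δ h : ℝ} {τ : Fin Q → Set (E d)}
    {x : Fin Q → E d} (hΩ : IsLipschitzDomain Ω) (hτ : IsPartition Ω δ h τ x) (i : Fin Q) :
    Metric.ball (x i) (δ * h) ⊆ Ω :=
  (interior_maximal ((hτ.inner i).trans (closure_mono (hτ.cover ▸ subset_iUnion τ i)))
    Metric.isOpen_ball).trans
    (interior_closure_subset_of_hasLipschitzBoundary hΩ.isOpen hΩ.lipschitz)

/-- The ball of radius `δ h` lies in `Ω`, whose diameter is at most `1`. A coordinate direction,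
available since `d ≥ 1`, exhibits two points of it at distance `δ h / 2`. -/
theorem IsPartition.half_radius_le_one {d Q : ℕ} (hd : 1 ≤ d) {Ω : Set (E d)} {δ h : ℝ}
    {τ : Fin Q → Set (E d)} {x : Fin Q → E d} (hΩ : IsLipschitzDomain Ω)
    (hτ : IsPartition Ω δ h τ x) (hδh : 0 < δ * h) (i : Fin Q) : δ * h / 2 ≤ 1 := by
  have hsub := hτ.ball_subset hΩ i
  let e : E d := EuclideanSpace.single ⟨0, hd⟩ 1
  have he : ‖(δ * h / 2) • e‖ = δ * h / 2 := by
    rw [norm_smul, Real.norm_of_nonneg (by positivity)]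
    simp [e]
  have h1 : x i ∈ Ω := hsub (Metric.mem_ball_self hδh)
  have h2 : x i + (δ * h / 2) • e ∈ Ω := hsub (by
    rw [mem_ball_iff_norm, add_sub_cancel_left, he]
    linarith)
  have h3 := (Metric.dist_le_diam_of_mem hΩ.bounded h2 h1).trans hΩ.diam_le
  rwa [dist_eq_norm, add_sub_cancel_left, he] at h3

/-- Only the closures of the cells contain the inner balls, and closures of disjoint sets may
overlap. Independence makes `δ_{x_j}` nonzero on `H_0^s(τ_j)`, so `τ_j` is a neighbourhood of `x_j`.
It would meet `τ_i` if `x_j` lay in the ball of radius `δ h` about `x_i`. Hence the centers are at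
least `δ h` apart. -/
theorem IsPartition.pairwise_disjoint_ball {d s Q : ℕ} (hs : (0 : ℝ) < (s : ℝ) - (d : ℝ) / 2)
    {Ω : Set (E d)} {δ h : ℝ} {τ : Fin Q → Set (E d)} {x : Fin Q → E d}
    (hτ : IsPartition Ω δ h τ x) {T : Fin Q → Type} {φ : ∀ i, T i → Hneg s Ω}
    (hφ : IsMeasurementFamily Ω τ T φ) (hdirac : ∀ i, {dirac s Ω (x i)} ⊆ range (φ i)) :
    Pairwise (Function.onFun Disjoint fun i => Metric.ball (x i) (δ * h / 2)) := by
  intro i j hij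
  obtain ⟨α, hα⟩ := hdirac j rfl
  obtain ⟨u, hu⟩ : ∃ u : {u : H0 s Ω // H0.jet u ∈ H0Sub s (τ j)}, φ j α u.1 ≠ 0 :=
    Function.ne_iff.1 ((hφ.linearIndependent j).ne_zero α)
  have hnhds : τ j ∈ 𝓝 (x j) := mem_nhds_of_dirac_ne_zero hs (hτ.cover ▸ subset_iUnion τ j) u.2
    (hα ▸ hu)
  have hnot : x j ∉ Metric.ball (x i) (δ * h) := fun hmem => by
    obtain ⟨y, hyj, hyi⟩ := mem_closure_iff_nhds.1 (hτ.inner i hmem) _ hnhds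
    exact (hτ.disjoint hij).le_bot ⟨hyi, hyj⟩
  refine Metric.ball_disjoint_ball ?_
  rw [Metric.mem_ball, not_lt, dist_comm] at hnot
  linarith

/-! ### Bounds for kernel matrices -/

theorem kernelMatrix_isHermitian {d s : ℕ} (hs : (0 : ℝ) < (s : ℝ) - (d : ℝ) / 2) {Ω : Set (E d)}
    {L : H0 s Ω ≃L[ℝ] Hneg s Ω} (hL : IsAdmissible L) {ι : Type} (φ : ι → Hneg s Ω) :
    (kernelMatrix (green L) φ).IsHermitian := by
  ext m n
  simp only [Matrix.conjTranspose_apply, star_trivial, kernelMatrix_green hs hL]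
  exact hL.symm_symm _ _

theorem dotProduct_kernelMatrix {d s : ℕ} (hs : (0 : ℝ) < (s : ℝ) - (d : ℝ) / 2) {Ω : Set (E d)}
    {L : H0 s Ω ≃L[ℝ] Hneg s Ω} (hL : IsAdmissible L) {ι : Type} [Fintype ι] (φ : ι → Hneg s Ω)
    (c : ι → ℝ) : c ⬝ᵥ (kernelMatrix (green L) φ).mulVec c =
      (∑ m, c m • φ m) (L.symm (∑ m, c m • φ m)) := by
  simp only [dotProduct, Matrix.mulVec, kernelMatrix_green hs hL, map_sum, map_smul,
    sum_apply, smul_apply, smul_eq_mul]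
  refine Finset.sum_congr rfl fun m _ => ?_
  congr 1
  exact Finset.sum_congr rfl fun n _ => by rw [mul_comm, hL.symm_symm]

theorem dotProduct_smul_one_mulVec {ι : Type} [Fintype ι] [DecidableEq ι] (k : ℝ) (c : ι → ℝ) :
    c ⬝ᵥ (k • (1 : Matrix ι ι ℝ)).mulVec c = k * ∑ m, c m ^ 2 := by
  rw [Matrix.smul_mulVec, Matrix.one_mulVec, dotProduct_smul, smul_eq_mul]
  simp [dotProduct, sq]

theorem isHermitian_smul_one {ι : Type} [DecidableEq ι] (k : ℝ) :
    (k • (1 : Matrix ι ι ℝ)).IsHermitian := by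
  ext i j
  simp [Matrix.one_apply, eq_comm]

/-- Duality: a bound on the analysis map `u ↦ (φ_m u)` is a bound on the synthesis map `c ↦ ∑ c_m
φ_m`, and `‖L⁻¹‖` controls the quadratic form. -/
theorem posSemidef_smul_one_sub_kernelMatrix {d s : ℕ} (hs : (0 : ℝ) < (s : ℝ) - (d : ℝ) / 2)
    {Ω : Set (E d)} {L : H0 s Ω ≃L[ℝ] Hneg s Ω} (hL : IsAdmissible L) {ι : Type} [Fintype ι]
    [DecidableEq ι] (φ : ι → Hneg s Ω) {D N k : ℝ} (hD0 : 0 ≤ D)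
    (hD : ∀ u, ∑ m, φ m u ^ 2 ≤ D * ‖u‖ ^ 2)
    (hN : ‖(L.symm : Hneg s Ω →L[ℝ] H0 s Ω)‖ ≤ N) (hk : D * N ≤ k) :
    (k • (1 : Matrix ι ι ℝ) - kernelMatrix (green L) φ).PosSemidef := by
  refine .of_dotProduct_mulVec_nonneg
    ((isHermitian_smul_one k).sub (kernelMatrix_isHermitian hs hL φ)) fun c => ?_
  rw [star_trivial, Matrix.sub_mulVec, dotProduct_sub, dotProduct_kernelMatrix hs hL,
    dotProduct_smul_one_mulVec, sub_nonneg]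
  set F := ∑ m, c m • φ m
  set S := ∑ m, c m ^ 2
  have hS : 0 ≤ S := Finset.sum_nonneg fun m _ => sq_nonneg _
  have hF : ‖F‖ ≤ √(S * D) := by
    refine F.opNorm_le_bound (Real.sqrt_nonneg _) fun u => ?_
    rw [Real.norm_eq_abs]
    refine abs_le_of_sq_le_sq ?_ (by positivity)
    rw [mul_pow, Real.sq_sqrt (by positivity), mul_assoc]
    have : F u = ∑ m, c m * φ m u := by simp [F, sum_apply]
    rw [this]
    exact (Finset.sum_mul_sq_le_sq_mul_sq _ _ _).trans (mul_le_mul_of_nonneg_left (hD u) hS)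
  calc F (L.symm F) ≤ ‖F‖ * (‖(L.symm : Hneg s Ω →L[ℝ] H0 s Ω)‖ * ‖F‖) :=
        (le_abs_self _).trans ((F.le_opNorm _).trans (mul_le_mul_of_nonneg_left
          ((L.symm : Hneg s Ω →L[ℝ] H0 s Ω).le_opNorm F) (norm_nonneg _)))
    _ = ‖F‖ ^ 2 * ‖(L.symm : Hneg s Ω →L[ℝ] H0 s Ω)‖ := by ring
    _ ≤ (√(S * D)) ^ 2 * N := by gcongr
    _ = D * N * S := by rw [Real.sq_sqrt (by positivity)]; ring
    _ ≤ k * S := by gcongr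

theorem IsAdmissible.nonneg {d s : ℕ} {Ω : Set (E d)} {L : H0 s Ω ≃L[ℝ] Hneg s Ω}
    (hL : IsAdmissible L) (u : H0 s Ω) : 0 ≤ L u u := by
  rcases eq_or_ne u 0 with rfl | hu
  · simp
  · exact (hL.pos u hu).le

theorem IsAdmissible.sq_apply_le {d s : ℕ} {Ω : Set (E d)} {L : H0 s Ω ≃L[ℝ] Hneg s Ω}
    (hL : IsAdmissible L) (y u : H0 s Ω) : L y u ^ 2 ≤ L y y * L u u := by
  have h : ∀ t : ℝ, 0 ≤ L u u * (t * t) + 2 * L y u * t + L y y := fun t => by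
    have := hL.nonneg (t • u + y)
    simp only [map_add, map_smul, add_apply, smul_apply,
      smul_eq_mul, hL.symm y u] at this
    linarith
  have := discrim_le_zero h
  unfold discrim at this
  linarith

/-- The trial function `u = ∑ c_m ψ_m` satisfies `F u = ∑ c_m²`. Energy Cauchy–Schwarz between `u`
and `L⁻¹ F` bounds the form from below. -/
theorem posSemidef_kernelMatrix_sub_smul_one {d s : ℕ} (hs : (0 : ℝ) < (s : ℝ) - (d : ℝ) / 2)
    {Ω : Set (E d)} {L : H0 s Ω ≃L[ℝ] Hneg s Ω} (hL : IsAdmissible L) {ι : Type} [Fintype ι]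
    [DecidableEq ι] (φ : ι → Hneg s Ω) (ψ : ι → H0 s Ω)
    (hψ : ∀ m n, φ m (ψ n) = if m = n then 1 else 0) {D N k : ℝ}
    (hD : ∀ c : ι → ℝ, ‖∑ m, c m • ψ m‖ ^ 2 ≤ D * ∑ m, c m ^ 2)
    (hN : ‖(L : H0 s Ω →L[ℝ] Hneg s Ω)‖ ≤ N) (hk0 : 0 ≤ k) (hk : k * (N * D) ≤ 1) :
    (kernelMatrix (green L) φ - k • (1 : Matrix ι ι ℝ)).PosSemidef := by
  refine .of_dotProduct_mulVec_nonneg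
    ((kernelMatrix_isHermitian hs hL φ).sub (isHermitian_smul_one k)) fun c => ?_
  rw [star_trivial, Matrix.sub_mulVec, dotProduct_sub, dotProduct_kernelMatrix hs hL,
    dotProduct_smul_one_mulVec, sub_nonneg]
  set F := ∑ m, c m • φ m
  set S := ∑ m, c m ^ 2
  have hS : 0 ≤ S := Finset.sum_nonneg fun m _ => sq_nonneg _
  set u := ∑ m, c m • ψ m
  set y := L.symm F
  have hLy : L y = F := L.apply_symm_apply F
  have hFu : F u = S := by
    simp [F, u, S, map_sum, sum_apply, hψ, sq]
  have hFy : 0 ≤ F y := hLy ▸ hL.nonneg y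
  have h1 := hL.sq_apply_le y u
  rw [hLy, hFu] at h1
  have h2 : L u u ≤ N * (D * S) :=
    calc L u u ≤ ‖(L : H0 s Ω →L[ℝ] Hneg s Ω)‖ * ‖u‖ * ‖u‖ :=
          (le_abs_self _).trans ((L : H0 s Ω →L[ℝ] Hneg s Ω).le_opNorm₂ u u)
      _ = ‖(L : H0 s Ω →L[ℝ] Hneg s Ω)‖ * ‖u‖ ^ 2 := by ring
      _ ≤ N * ‖u‖ ^ 2 := by gcongr
      _ ≤ N * (D * S) := mul_le_mul_of_nonneg_left (hD c) ((ContinuousLinearMap.opNorm_nonneg _).trans hN)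
  -- The inequality obtained is quadratic in `S`. One factor is cancelled, so `S = 0` is treated
  -- apart.
  rcases hS.eq_or_lt with h0 | h0
  · rw [← h0, mul_zero]; exact hFy
  · refine le_of_mul_le_mul_right ?_ h0
    calc k * S * S = k * S ^ 2 := by ring
      _ ≤ k * (F y * (N * (D * S))) := by gcongr; exact h1.trans (by gcongr)
      _ = k * (N * D) * (F y * S) := by ring
      _ ≤ F y * S := mul_le_of_le_one_left (by positivity) hk

/-! ### Estimates for families of measurements -/

theorem sum_ballNormSq_le_norm_sq {d s Q : ℕ} {S : Set (E d)} {f : E d → ℝ} (hf : IsTest S f)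
    {x : Fin Q → E d} {r : ℝ}
    (hx : Pairwise (Function.onFun Disjoint fun i => Metric.ball (x i) r)) :
    ∑ i, ballNormSq s f (x i) r ≤ ‖hf.toH0 s‖ ^ 2 := by
  simp only [norm_sq_toH0, ballNormSq]
  rw [Finset.sum_comm]
  refine Finset.sum_le_sum fun β _ => ?_
  have hint : Integrable (fun z => mderiv β.1 f z ^ 2) := (hf.mderiv β.1).memLp.integrable_sq
  rw [← integral_iUnion_fintype (fun i => measurableSet_ball) hx fun i => hint.integrableOn]
  exact setIntegral_le_integral hint (Filter.Eventually.of_forall fun z => sq_nonneg _)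

theorem card_le_of_injective_multiIndex {d J : ℕ} {T : Type} [Fintype T] {γ : T → Fin d → ℕ}
    (hγ : ∀ α, ∑ j, γ α j ≤ J) (hinj : Function.Injective γ) :
    Fintype.card T ≤ Fintype.card (MultiIndex d J) :=
  Fintype.card_le_of_injective (fun α => (⟨γ α, hγ α⟩ : MultiIndex d J))
    fun _ _ h => hinj (congrArg Subtype.val h)

/-- The local Sobolev inequalities add up because the balls are disjoint. Distinct multi-indices
bound the number of terms at each point, so the constant does not depend on `Q`. -/
theorem exists_sum_sq_diracDeriv_le {d s J : ℕ} (hJ : (J : ℝ) < (s : ℝ) - (d : ℝ) / 2) :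
    ∃ C : ℝ, 0 < C ∧ ∀ (Ω : Set (E d)) (Q : ℕ) (x : Fin Q → E d) (r : ℝ), 0 < r → r ≤ 1 →
      Pairwise (Function.onFun Disjoint fun i => Metric.ball (x i) r) →
      ∀ (T : Fin Q → Type) [∀ i, Fintype (T i)] (γ : ∀ i, T i → Fin d → ℕ),
      (∀ i α, ∑ j, γ i α j ≤ J) → (∀ i, Function.Injective (γ i)) → ∀ u : H0 s Ω,
      ∑ m : Σ i, T i, diracDeriv s Ω (x m.1) (γ m.1 m.2) u ^ 2 ≤ C * (r ^ d)⁻¹ * ‖u‖ ^ 2 := by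
  obtain ⟨C, hC, h⟩ := exists_sobolev_ball hJ
  set M : ℝ := ((Fintype.card (MultiIndex d J) : ℕ) : ℝ)
  refine ⟨M * C + 1, by positivity, fun Ω Q x r hr hr1 hx T _ γ hγ hinj u => ?_⟩
  -- Both sides are continuous in `u`, so test functions suffice.
  refine (denseRange_testToH0 s Ω).induction_on u (isClosed_le (by fun_prop) (by fun_prop)) ?_
  intro f
  have hf : IsTest Ω f.1 := f.2
  have hC' : 0 ≤ C * (r ^ d)⁻¹ := by positivity
  have hnn : ∀ i, 0 ≤ ballNormSq s f.1 (x i) r := fun i =>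
    Finset.sum_nonneg fun β _ => integral_nonneg fun z => sq_nonneg _
  calc ∑ m : Σ i, T i, diracDeriv s Ω (x m.1) (γ m.1 m.2) (hf.toH0 s) ^ 2
      = ∑ i, ∑ α : T i, mderiv (γ i α) f.1 (x i) ^ 2 := by
        rw [Fintype.sum_sigma]
        exact Finset.sum_congr rfl fun i _ => Finset.sum_congr rfl fun α _ => by
          rw [diracDeriv_toH0 hJ (x i) (hγ i α) hf]
    _ ≤ ∑ i, M * (C * (r ^ d)⁻¹ * ballNormSq s f.1 (x i) r) := by
        refine Finset.sum_le_sum fun i _ => ?_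
        refine (Finset.sum_le_sum fun α _ => h f.1 hf.smooth (x i) r hr hr1 _ (hγ i α)).trans ?_
        rw [Finset.sum_const, nsmul_eq_mul, Finset.card_univ]
        refine mul_le_mul_of_nonneg_right ?_ (mul_nonneg hC' (hnn i))
        exact Nat.cast_le.2 (card_le_of_injective_multiIndex (hγ i) (hinj i))
    _ = M * (C * (r ^ d)⁻¹) * ∑ i, ballNormSq s f.1 (x i) r := by
        rw [Finset.mul_sum]
        exact Finset.sum_congr rfl fun i _ => by ring
    _ ≤ M * (C * (r ^ d)⁻¹) * ‖hf.toH0 s‖ ^ 2 :=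
        mul_le_mul_of_nonneg_left (sum_ballNormSq_le_norm_sq hf hx) (by positivity)
    _ ≤ (M * C + 1) * (r ^ d)⁻¹ * ‖hf.toH0 s‖ ^ 2 := by
        rw [← mul_assoc]
        gcongr
        linarith

/-! ### Rescaled dual bumps and the biorthogonal family. -/

theorem tsupport_comp_affine_subset {d : ℕ} {f : E d → ℝ} (hf : IsTest (Metric.ball 0 1) f)
    (a : E d) {r : ℝ} (hr : 0 < r) :
    tsupport (fun x => f (r⁻¹ • (x - a))) ⊆ Metric.ball a r := by
  have hc : Continuous fun x : E d => r⁻¹ • (x - a) := by fun_prop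
  have h1 : tsupport (fun x => f (r⁻¹ • (x - a))) ⊆ (fun x => r⁻¹ • (x - a)) ⁻¹' tsupport f :=
    closure_minimal (fun x hx => subset_tsupport f hx) ((isClosed_tsupport f).preimage hc)
  intro x hx
  have h2 := mem_ball_zero_iff.1 (hf.subset (h1 hx))
  rw [norm_smul, norm_inv, Real.norm_of_nonneg hr.le, inv_mul_lt_iff₀ hr, mul_one] at h2
  exact mem_ball_iff_norm.2 h2

theorem integral_comp_affine {d : ℕ} (F : E d → ℝ) (a : E d) {r : ℝ} (hr : 0 < r) :
    ∫ x, F (r⁻¹ • (x - a)) = r ^ d * ∫ x, F x := by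
  rw [integral_sub_right_eq_self (fun x => F (r⁻¹ • x)) a,
    Measure.integral_comp_inv_smul_of_nonneg _ _ hr.le, finrank_euclideanSpace_fin, smul_eq_mul]

/-- The function `r^{|γ|} Ψ_γ((x - a) / r)` keeps its dual derivatives at `a`. Its derivatives of
order at most `s` cost at most `r^{-s}` each since `r ≤ 1`, and the volume contributes `r^d`. -/
theorem exists_test_dual_mderiv_ball (d s J : ℕ) :
    ∃ C : ℝ, 0 < C ∧ ∀ (a : E d) (r : ℝ), 0 < r → r ≤ 1 → ∀ γ : Fin d → ℕ, ∑ j, γ j ≤ J →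
      ∃ ψ : E d → ℝ, ∃ hψ : IsTest (Metric.ball a r) ψ,
        (∀ β : Fin d → ℕ, mderiv β ψ a = if β = γ then 1 else 0) ∧
        ‖hψ.toH0 s‖ ^ 2 ≤ C * (r ^ d * (r ^ (2 * s))⁻¹) := by
  choose Ψ hΨ hdual using fun γ : Fin d → ℕ => exists_test_dual_mderiv γ
  let N : (Fin d → ℕ) → ℝ := fun γ => ∑ β : MultiIndex d s, ∫ z, mderiv β.1 (Ψ γ) z ^ 2
  have hN : ∀ γ, 0 ≤ N γ := fun γ =>
    Finset.sum_nonneg fun β _ => integral_nonneg fun z => sq_nonneg _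
  -- Only finitely many `γ` occur, and the sum of their norms serves as a uniform constant.
  refine ⟨∑ γ : MultiIndex d J, N γ.1 + 1, by
    have := Finset.sum_nonneg fun (γ : MultiIndex d J) (_ : γ ∈ Finset.univ) => hN γ.1
    linarith, fun a r hr hr1 γ hγ => ?_⟩
  set k := ∑ j, γ j
  set f : E d → ℝ := fun x => Ψ γ (r⁻¹ • (x - a))
  have hf : ContDiff ℝ ∞ f := contDiff_comp_affine (hΨ γ).smooth _ _
  have hsub : tsupport f ⊆ Metric.ball a r := tsupport_comp_affine_subset (hΨ γ) a hr
  have hft : IsTest (Metric.ball a r) f :=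
    ⟨hf, HasCompactSupport.of_support_subset_isCompact (isCompact_closedBall a r)
      ((subset_tsupport f).trans (hsub.trans Metric.ball_subset_closedBall)), hsub⟩
  have hψ : IsTest (Metric.ball a r) (r ^ k • f) := (testSubmodule _).smul_mem (r ^ k) hft
  have hder : ∀ β : Fin d → ℕ, mderiv β (r ^ k • f) =
      fun x => r ^ k * (r⁻¹ ^ (∑ j, β j) * mderiv β (Ψ γ) (r⁻¹ • (x - a))) := fun β => by
    rw [mderiv_smul hf, mderiv_comp_affine (hΨ γ).smooth]
    rfl
  refine ⟨r ^ k • f, hψ, fun β => ?_, ?_⟩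
  · rw [hder]
    simp only [sub_self, smul_zero, hdual]
    split_ifs with h
    · subst h
      rw [mul_one, inv_pow, mul_inv_cancel₀ (by positivity)]
    · simp
  · rw [norm_sq_toH0]
    have hβ : ∀ β : MultiIndex d s, ∫ z, mderiv β.1 (r ^ k • f) z ^ 2 ≤
        (r ^ d * (r ^ (2 * s))⁻¹) * ∫ z, mderiv β.1 (Ψ γ) z ^ 2 := fun β => by
      have h1 : ∀ z, mderiv β.1 (r ^ k • f) z ^ 2 =
          (r ^ k * r⁻¹ ^ (∑ j, β.1 j)) ^ 2 * mderiv β.1 (Ψ γ) (r⁻¹ • (z - a)) ^ 2 := fun z => by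
        rw [hder]; ring
      simp_rw [h1]
      rw [integral_const_mul, integral_comp_affine (fun z => mderiv β.1 (Ψ γ) z ^ 2) a hr,
        ← mul_assoc]
      refine mul_le_mul_of_nonneg_right ?_ (integral_nonneg fun z => sq_nonneg _)
      rw [mul_comm]
      refine mul_le_mul_of_nonneg_left ?_ (by positivity)
      calc (r ^ k * r⁻¹ ^ (∑ j, β.1 j)) ^ 2 ≤ (1 * r⁻¹ ^ s) ^ 2 := by
            gcongr
            · exact pow_le_one₀ hr.le hr1
            · exact (one_le_inv₀ hr).2 hr1
            · exact β.2
        _ = (r ^ (2 * s))⁻¹ := by rw [one_mul, inv_pow, inv_pow, ← pow_mul, mul_comm s]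
    refine (Finset.sum_le_sum fun β _ => hβ β).trans ?_
    rw [← Finset.mul_sum, mul_comm]
    refine mul_le_mul_of_nonneg_right ?_ (by positivity)
    let γ₀ : MultiIndex d J := ⟨γ, hγ⟩
    have := Finset.single_le_sum (f := fun γ : MultiIndex d J => N γ.1) (fun γ _ => hN γ.1)
      (Finset.mem_univ γ₀)
    change N γ ≤ _
    linarith [show N γ ≤ _ from this]

theorem inner_toH0_eq_zero {d s : ℕ} {Ω S S' : Set (E d)} {f g : E d → ℝ} (hf : IsTest S f)
    (hg : IsTest S' g) (hS : Disjoint S S') (hfΩ : IsTest Ω f) (hgΩ : IsTest Ω g) :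
    inner ℝ (hfΩ.toH0 s) (hgΩ.toH0 s) = 0 := by
  change inner ℝ (hfΩ.toJet s) (hgΩ.toJet s) = 0
  rw [PiLp.inner_apply]
  refine Finset.sum_eq_zero fun β _ => ?_
  rw [L2.inner_def]
  refine integral_eq_zero_of_ae ?_
  filter_upwards [MemLp.coeFn_toLp (hfΩ.mderiv β.1).memLp,
    MemLp.coeFn_toLp (hgΩ.mderiv β.1).memLp] with z hz hz'
  change inner ℝ (MemLp.toLp _ (hfΩ.mderiv β.1).memLp z)
    (MemLp.toLp _ (hgΩ.mderiv β.1).memLp z) = 0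
  rw [hz, hz']
  by_cases hzS : z ∈ S
  · have : mderiv β.1 g z = 0 := image_eq_zero_of_notMem_tsupport fun h =>
      hS.le_bot ⟨hzS, (hg.mderiv β.1).subset h⟩
    simp [this]
  · have : mderiv β.1 f z = 0 := image_eq_zero_of_notMem_tsupport fun h =>
      hzS ((hf.mderiv β.1).subset h)
    simp [this]

/-- Pythagoras across the cells and Cauchy–Schwarz within each cell, so only the size of one cell's
index set enters, not the number of cells. -/
theorem norm_sq_sum_sigma_le {H : Type*} [NormedAddCommGroup H] [InnerProductSpace ℝ H]
    {ι : Type} [Fintype ι] {T : ι → Type} [∀ i, Fintype (T i)] {ψ : (Σ i, T i) → H}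
    (horth : ∀ m n : Σ i, T i, m.1 ≠ n.1 → inner ℝ (ψ m) (ψ n) = 0) {B M : ℝ} (hB0 : 0 ≤ B)
    (hB : ∀ m, ‖ψ m‖ ^ 2 ≤ B) (hM : ∀ i, (Fintype.card (T i) : ℝ) ≤ M) (c : (Σ i, T i) → ℝ) :
    ‖∑ m, c m • ψ m‖ ^ 2 ≤ M * B * ∑ m, c m ^ 2 := by
  let u : ι → H := fun i => ∑ α : T i, c ⟨i, α⟩ • ψ ⟨i, α⟩
  have hsum : ∑ m, c m • ψ m = ∑ i, u i := Fintype.sum_sigma _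
  have horth' : ∀ i k, k ≠ i → inner ℝ (u i) (u k) = 0 := fun i k hik => by
    simp only [u, sum_inner, inner_sum]
    exact Finset.sum_eq_zero fun α _ => Finset.sum_eq_zero fun β _ => by
      rw [inner_smul_left, inner_smul_right, horth _ _ (by simpa using hik.symm)]
      simp
  have hpyth : ‖∑ i, u i‖ ^ 2 = ∑ i, ‖u i‖ ^ 2 := by
    rw [← real_inner_self_eq_norm_sq, sum_inner]
    refine Finset.sum_congr rfl fun i _ => ?_
    rw [inner_sum, Finset.sum_eq_single i (fun k _ hk => horth' i k hk) (by simp),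
      real_inner_self_eq_norm_sq]
  rw [hsum, hpyth, Fintype.sum_sigma, Finset.mul_sum]
  refine Finset.sum_le_sum fun i _ => ?_
  have hnn : 0 ≤ ∑ α : T i, c ⟨i, α⟩ ^ 2 := Finset.sum_nonneg fun _ _ => sq_nonneg _
  calc ‖u i‖ ^ 2 ≤ (∑ α : T i, ‖c ⟨i, α⟩ • ψ ⟨i, α⟩‖) ^ 2 := by
        gcongr; exact norm_sum_le _ _
    _ ≤ Fintype.card (T i) * ∑ α : T i, ‖c ⟨i, α⟩ • ψ ⟨i, α⟩‖ ^ 2 :=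
        sq_sum_le_card_mul_sum_sq
    _ ≤ Fintype.card (T i) * ∑ α : T i, B * c ⟨i, α⟩ ^ 2 := by
        gcongr with α
        rw [norm_smul, mul_pow, Real.norm_eq_abs, sq_abs, mul_comm]
        exact mul_le_mul_of_nonneg_right (hB _) (sq_nonneg _)
    _ = Fintype.card (T i) * (B * ∑ α : T i, c ⟨i, α⟩ ^ 2) := by rw [← Finset.mul_sum]
    _ ≤ M * (B * ∑ α : T i, c ⟨i, α⟩ ^ 2) := mul_le_mul_of_nonneg_right (hM i) (by positivity)
    _ = _ := by ring

theorem exists_biorthogonal_family {d s J : ℕ} (hJ : (J : ℝ) < (s : ℝ) - (d : ℝ) / 2) :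
    ∃ C : ℝ, 0 < C ∧ ∀ (Ω : Set (E d)) (Q : ℕ) (x : Fin Q → E d) (r : ℝ), 0 < r → r ≤ 1 →
      Pairwise (Function.onFun Disjoint fun i => Metric.ball (x i) r) →
      (∀ i, Metric.ball (x i) r ⊆ Ω) →
      ∀ (T : Fin Q → Type) [∀ i, Fintype (T i)] [∀ i, DecidableEq (T i)]
        (γ : ∀ i, T i → Fin d → ℕ),
      (∀ i α, ∑ j, γ i α j ≤ J) → (∀ i, Function.Injective (γ i)) →
      ∃ ψ : (Σ i, T i) → H0 s Ω,
        (∀ m n : Σ i, T i, diracDeriv s Ω (x m.1) (γ m.1 m.2) (ψ n) = if m = n then 1 else 0) ∧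
        ∀ c : (Σ i, T i) → ℝ,
          ‖∑ m, c m • ψ m‖ ^ 2 ≤ C * (r ^ d * (r ^ (2 * s))⁻¹) * ∑ m, c m ^ 2 := by
  obtain ⟨C, hC, h⟩ := exists_test_dual_mderiv_ball d s J
  set M : ℝ := ((Fintype.card (MultiIndex d J) : ℕ) : ℝ)
  have hM : 0 < M := by
    have : Nonempty (MultiIndex d J) := ⟨⟨0, by simp⟩⟩
    exact Nat.cast_pos.2 Fintype.card_pos
  refine ⟨M * C, by positivity, fun Ω Q x r hr hr1 hx hxΩ T _ _ γ hγ hinj => ?_⟩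
  choose f hf hdual hnorm using fun m : Σ i, T i => h (x m.1) r hr hr1 (γ m.1 m.2) (hγ m.1 m.2)
  have hfΩ : ∀ m, IsTest Ω (f m) := fun m =>
    ⟨(hf m).smooth, (hf m).compact, (hf m).subset.trans (hxΩ m.1)⟩
  refine ⟨fun m => (hfΩ m).toH0 s, fun m n => ?_, fun c => ?_⟩
  · rw [diracDeriv_toH0 hJ _ (hγ _ _)]
    obtain ⟨i, α⟩ := m
    obtain ⟨k, β⟩ := n
    rcases eq_or_ne i k with rfl | hik
    · rw [hdual ⟨i, β⟩]
      simp [(hinj i).eq_iff]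
    · rw [if_neg fun he => hik (congrArg Sigma.fst he)]
      refine image_eq_zero_of_notMem_tsupport fun hmem => ?_
      exact (hx hik).le_bot ⟨Metric.mem_ball_self hr, ((hf ⟨k, β⟩).mderiv _).subset hmem⟩
  · rw [mul_assoc M C]
    refine norm_sq_sum_sigma_le (ψ := fun m => (hfΩ m).toH0 s) (B := C * (r ^ d * (r ^ (2 * s))⁻¹)) (fun m n hmn => ?_) (by positivity) (fun m => ?_) (fun i => ?_) c
    · exact inner_toH0_eq_zero (hf m) (hf n) (hx hmn) _ _
    -- The norm is the same whether the bump is regarded as an element for the ball or for `Ω`.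
    · refine le_trans (le_of_eq ?_) (hnorm m)
      rw [norm_sq_toH0, norm_sq_toH0]
    · exact Nat.cast_le.2 (card_le_of_injective_multiIndex (hγ i) (hinj i))

/-- Independence makes the measurements at one point distinct, hence also their multi-indices. This
is what permits counting them and makes biorthogonality meaningful. -/
theorem exists_multiIndex_of_range_subset {d s Q J : ℕ} {Ω : Set (E d)} {τ : Fin Q → Set (E d)}
    {x : Fin Q → E d} {T : Fin Q → Type} {φ : ∀ i, T i → Hneg s Ω}
    (hφ : IsMeasurementFamily Ω τ T φ)
    (hrange : ∀ i, range (φ i) ⊆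
      {ψ | ∃ γ : Fin d → ℕ, ∑ j, γ j ≤ J ∧ ψ = diracDeriv s Ω (x i) γ}) :
    ∃ γ : ∀ i, T i → Fin d → ℕ, (∀ i α, ∑ j, γ i α j ≤ J) ∧ (∀ i, Function.Injective (γ i)) ∧
      ∀ i α, φ i α = diracDeriv s Ω (x i) (γ i α) := by
  choose γ hγ heq using fun i (α : T i) => hrange i ⟨α, rfl⟩
  refine ⟨γ, hγ, fun i α β hαβ => (hφ.linearIndependent i).injective ?_, heq⟩
  simp only [heq, hαβ]

end KernelBounds

end

/-! ### The two-sided bound. -/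

theorem mainTheorem5 (d s J : ℕ) (hd : 1 ≤ d) (hJ : (J : ℝ) < (s : ℝ) - (d : ℝ) / 2)
    (δ : ℝ) (hδ : δ ∈ Set.Ioo (0 : ℝ) 1) (normL normLinv : ℝ) :
    ∃ Cmin : ℝ, 0 < Cmin ∧
      ∀ Ω : Set (KernelBounds.E d), KernelBounds.IsLipschitzDomain Ω →
      ∃ Cmax : ℝ, 0 < Cmax ∧
        ∀ (L : KernelBounds.H0 s Ω ≃L[ℝ] KernelBounds.Hneg s Ω),
        KernelBounds.IsAdmissible L →
        ‖(L : KernelBounds.H0 s Ω →L[ℝ] KernelBounds.Hneg s Ω)‖ = normL →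
        ‖(L.symm : KernelBounds.Hneg s Ω →L[ℝ] KernelBounds.H0 s Ω)‖ = normLinv →
        ∀ (h : ℝ), 0 < h →
        ∀ (Q : ℕ) (τ : Fin Q → Set (KernelBounds.E d)) (x : Fin Q → KernelBounds.E d),
        KernelBounds.IsPartition Ω δ h τ x →
        ∀ (T : Fin Q → Type) [∀ i, Fintype (T i)] [∀ i, DecidableEq (T i)]
          (φ : ∀ i, T i → KernelBounds.Hneg s Ω),
        KernelBounds.IsMeasurementFamily Ω τ T φ →
        (∀ i, {KernelBounds.dirac s Ω (x i)} ⊆ Set.range (φ i)) →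
        (∀ i, Set.range (φ i) ⊆
          {ψ | ∃ γ : Fin d → ℕ, ∑ j, γ j ≤ J ∧ ψ = KernelBounds.diracDeriv s Ω (x i) γ}) →
        ((Cmax * h ^ (-(d : ℤ))) • (1 : Matrix (Σ i, T i) (Σ i, T i) ℝ) -
          KernelBounds.kernelMatrix (KernelBounds.green L) (fun m : Σ i, T i => φ m.1 m.2)).PosSemidef ∧
        (KernelBounds.kernelMatrix (KernelBounds.green L) (fun m : Σ i, T i => φ m.1 m.2) -
          (Cmin * h ^ (2 * (s : ℤ) - (d : ℤ))) •
            (1 : Matrix (Σ i, T i) (Σ i, T i) ℝ)).PosSemidef := by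
  have hδ0 : 0 < δ := hδ.1
  have hs : (0 : ℝ) < (s : ℝ) - (d : ℝ) / 2 := (Nat.cast_nonneg J).trans_lt hJ
  obtain ⟨A, hA, hupper⟩ := KernelBounds.exists_sum_sq_diracDeriv_le hJ
  obtain ⟨B, hB, hlower⟩ := KernelBounds.exists_biorthogonal_family hJ
  -- The prescribed norms are arbitrary reals, fixed before `L`. Replacing them by these majorants
  -- keeps the constants positive in every case.
  have hN : 0 < |normL| + 1 := by positivity
  have hN' : 0 < |normLinv| + 1 := by positivity
  -- The powers of `δ / 2` come from writing `r = (δ / 2) h` in `r^{2s-d}` and `r^{-d}`.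
  refine ⟨((|normL| + 1) * B)⁻¹ * ((δ / 2) ^ (2 * s) * ((δ / 2) ^ d)⁻¹), by positivity,
    fun Ω hΩ => ⟨A * ((δ / 2) ^ d)⁻¹ * (|normLinv| + 1), by positivity, ?_⟩⟩
  intro L hL hnL hnLinv h hh Q τ x hτ T _ _ φ hφ hdirac hrange
  obtain ⟨γ, hγ, hinj, heq⟩ := KernelBounds.exists_multiIndex_of_range_subset hφ hrange
  have hδh : 0 < δ * h := mul_pos hδ0 hh
  have hr : 0 < δ * h / 2 := half_pos hδh
  -- A cell exists because `Ω` is nonempty, and one cell is enough to bound `h`.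
  have hr1 : δ * h / 2 ≤ 1 := by
    obtain ⟨y, hy⟩ := hΩ.connected.nonempty
    rw [← hτ.cover] at hy
    obtain ⟨i, -⟩ := Set.mem_iUnion.1 hy
    exact hτ.half_radius_le_one hd hΩ hδh i
  have hdisj := hτ.pairwise_disjoint_ball hs hφ hdirac
  have hball : ∀ i, Metric.ball (x i) (δ * h / 2) ⊆ Ω := fun i =>
    (Metric.ball_subset_ball (by linarith)).trans (hτ.ball_subset hΩ i)
  have hreq : δ * h / 2 = δ / 2 * h := by ring
  constructor
  · refine KernelBounds.posSemidef_smul_one_sub_kernelMatrix hs hL _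
      (D := A * ((δ * h / 2) ^ d)⁻¹) (N := |normLinv| + 1) (by positivity) (fun u => ?_) ?_ ?_
    · simp only [heq]
      exact hupper Ω Q x _ hr hr1 hdisj T γ hγ hinj u
    · rw [hnLinv]; linarith [le_abs_self normLinv]
    · rw [hreq, mul_pow, mul_inv, zpow_neg, zpow_natCast]
      exact le_of_eq (by ring)
  · obtain ⟨ψ, hψ, hnorm⟩ := hlower Ω Q x _ hr hr1 hdisj hball T γ hγ hinj
    refine KernelBounds.posSemidef_kernelMatrix_sub_smul_one hs hL _ ψ (fun m n => ?_) hnorm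
      (N := |normL| + 1) ?_ (by positivity) ?_
    · rw [heq]; exact hψ m n
    · rw [hnL]; linarith [le_abs_self normL]
    · rw [hreq, zpow_sub₀ hh.ne', zpow_natCast,
        show (2 * (s : ℤ)) = ((2 * s : ℕ) : ℤ) by push_cast; rfl, zpow_natCast, mul_pow, mul_pow]
      refine le_of_eq ?_
      field_simp
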